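/- Let $N\ge 2$, let $B_r(x_0)$ denote the open ball in $\mathbb{R}^N$ of radius $r>0$ centred at $x_0$, and write $B_r=B_r(0)$. Let $h\in\mathbb{R}\cup\{+\infty\}$, $h\neq 0$. Let $\alpha>0$, let $\Omega_{\mathrm{out}}\subset\mathbb{R}^N$ be an open set with $\overline{B_\alpha}\subset\Omega_{\mathrm{out}}$, and assume that $\Omega=\Omega_{\mathrm{out}}\setminus\overline{B_\alpha}$ is a bounded Lipschitz domain (a non-empty bounded connected open set with Lipschitz boundary). Let $\beta>\alpha$ be such that $|B_\beta\setminus\overline{B_\alpha}|=|\Omega|$, where $|\cdot|$ is the Lebesgue measure. For $D=\Omega$ and for $D=B_\beta\setminus\overline{B_\alpha}$, let $\tau_1(D)$ be the first eigenvalue of the Laplacian with the Robin condition $\frac{\partial u}{\partial\eta}+hu=0$ on $\partial B_\alpha$ (the Dirichlet condition $u=0$ if $h=+\infty$) and the Neumann condition $\frac{\partial u}{\partial\eta}=0$ on the rest of $\partial D$, where $\eta$ is the outward unit normal, that is, $$ \tau_1(D)=\inf\left\{\frac{\int_D|\nabla u|^2\,dx+h\int_{\partial B_\alpha}u^2\,dS}{\int_D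 u^2\,dx}:\ u\in \tilde H^1(D)\setminus\{0\}\right\}, $$ where $\tilde H^1(D)=H^1(D)$ if $h<+\infty$, while for $h=+\infty$ the space $\tilde H^1(D)$ consists of all $u\in H^1(D)$ with zero trace on $\partial B_\alpha$ and the boundary term is read as $0$. Then both infima are finite, and $$ \tau_1(\Omega)\le\tau_1(B_\beta\setminus\overline{B_\alpha}). $$ Moreover, equality holds if and only if $\Omega=B_\beta\setminus\overline{B_\alpha}$. -/

import Mathlib

open MeasureTheory Metric Filter Topology
open scoped ContDiff

noncomputable section

/-- `Ω` has a Lipschitz boundary: near each boundary point, in suitable orthonormal coordinates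
with vertical unit axis `e`, the set `Ω` is the strict epigraph of a Lipschitz function of the
horizontal component `x - ⟪e, x⟫ e`. -/
def HasLipschitzBoundary {N : ℕ} (Ω : Set (EuclideanSpace ℝ (Fin N))) : Prop :=
  ∀ x₀ ∈ frontier Ω, ∃ (e : EuclideanSpace ℝ (Fin N)) (K : NNReal)
    (γ : EuclideanSpace ℝ (Fin N) → ℝ) (U : Set (EuclideanSpace ℝ (Fin N))),
    ‖e‖ = 1 ∧ LipschitzWith K γ ∧ IsOpen U ∧ x₀ ∈ U ∧
      ∀ x ∈ U, x ∈ Ω ↔ γ (x - inner ℝ e x • e) < inner ℝ e x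

/-- A bounded Lipschitz domain; `IsConnected` includes non-emptiness. -/
structure IsBoundedLipschitzDomain {N : ℕ} (Ω : Set (EuclideanSpace ℝ (Fin N))) : Prop where
  isOpen : IsOpen Ω
  isConnected : IsConnected Ω
  isBounded : Bornology.IsBounded Ω
  lipschitz : HasLipschitzBoundary Ω

/-- The standing assumption on `Ω = Ωout \ closure B_α`: it is a bounded Lipschitz domain, `Ωout`
is open, `α > 0`, and `B_α` (centred at the origin) is compactly contained in `Ωout`. -/
structure AssumptionA {N : ℕ} (Ωout : Set (EuclideanSpace ℝ (Fin N))) (α : ℝ) : Prop where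
  isOpen_out : IsOpen Ωout
  pos : 0 < α
  compactly_contained : closedBall 0 α ⊆ Ωout
  domain : IsBoundedLipschitzDomain (Ωout \ closedBall 0 α)

/-- `u ∈ H¹(Ω)` with weak gradient `g`: both are square integrable on `Ω`, and
`∫_Ω u ∂_v φ = - ∫_Ω ⟪g, v⟫ φ` for every direction `v` and every test function
`φ ∈ C_c^∞(Ω)`. -/
structure MemH1 {N : ℕ} (Ω : Set (EuclideanSpace ℝ (Fin N)))
    (u : EuclideanSpace ℝ (Fin N) → ℝ)
    (g : EuclideanSpace ℝ (Fin N) → EuclideanSpace ℝ (Fin N)) : Prop where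
  memLp : MemLp u 2 (volume.restrict Ω)
  memLp_grad : MemLp g 2 (volume.restrict Ω)
  weak_grad : ∀ φ : EuclideanSpace ℝ (Fin N) → ℝ, ContDiff ℝ ∞ φ → HasCompactSupport φ →
    tsupport φ ⊆ Ω → ∀ v : EuclideanSpace ℝ (Fin N),
      ∫ x in Ω, u x * fderiv ℝ φ x v = - ∫ x in Ω, inner ℝ (g x) v * φ x

/-- The surface measure `dS` of the sphere `∂B_α` (centred at the origin), as a measure on `ℝ^N`:
the image of the surface measure of the unit sphere under `ω ↦ α ω`, multiplied by
`α ^ (N - 1)`. -/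
def sphereSurface (N : ℕ) (α : ℝ) : Measure (EuclideanSpace ℝ (Fin N)) :=
  ENNReal.ofReal (α ^ (N - 1)) •
    Measure.map (fun z : sphere (0 : EuclideanSpace ℝ (Fin N)) 1 => α • z.1)
      (Measure.toSphere (volume : Measure (EuclideanSpace ℝ (Fin N))))

/-- `T ∈ L²(∂B_α)` is the trace on `∂B_α` of the `H¹(Ω)` function `u` with weak gradient `g`:
the value at `u` of the extension by continuity, from functions that are `C¹` up to the boundary
to `H¹(Ω)`, of the restriction map to `∂B_α`. -/
structure IsTraceOnSphere {N : ℕ} (Ω : Set (EuclideanSpace ℝ (Fin N))) (α : ℝ)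
    (u : EuclideanSpace ℝ (Fin N) → ℝ)
    (g : EuclideanSpace ℝ (Fin N) → EuclideanSpace ℝ (Fin N))
    (T : EuclideanSpace ℝ (Fin N) → ℝ) : Prop where
  memLp : MemLp T 2 (sphereSurface N α)
  approx : ∃ w : ℕ → EuclideanSpace ℝ (Fin N) → ℝ, (∀ n, ContDiff ℝ 1 (w n)) ∧
    Tendsto (fun n => eLpNorm (fun x => w n x - u x) 2 (volume.restrict Ω)) atTop (𝓝 0) ∧
    Tendsto (fun n => eLpNorm (fun x => gradient (w n) x - g x) 2 (volume.restrict Ω))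
      atTop (𝓝 0) ∧
    Tendsto (fun n => eLpNorm (fun x => w n x - T x) 2 (sphereSurface N α)) atTop (𝓝 0)

/-- The values of the Rayleigh quotient
`(∫_Ω |∇u|² + h ∫_{∂B_α} u² dS) / ∫_Ω u²` over the nonzero `u ∈ H¹(Ω)`, where for `h = +∞`
the functions are required to have zero trace on `∂B_α` and the boundary term is read as `0`. -/
def rayleighValues {N : ℕ} (h : WithTop ℝ) (α : ℝ) (Ω : Set (EuclideanSpace ℝ (Fin N))) :
    Set ℝ :=
  {ρ | ∃ (u : EuclideanSpace ℝ (Fin N) → ℝ)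
      (g : EuclideanSpace ℝ (Fin N) → EuclideanSpace ℝ (Fin N))
      (T : EuclideanSpace ℝ (Fin N) → ℝ),
      MemH1 Ω u g ∧ IsTraceOnSphere Ω α u g T ∧
      (h = ⊤ → T =ᵐ[sphereSurface N α] 0) ∧
      ¬ u =ᵐ[volume.restrict Ω] 0 ∧
      ρ = ((∫ x in Ω, ‖g x‖ ^ 2) + h.untopD 0 * ∫ x, T x ^ 2 ∂(sphereSurface N α)) /
        ∫ x in Ω, u x ^ 2}

/-- The first eigenvalue `τ₁(Ω)` of the mixed problem: Robin with parameter `h` (Dirichlet if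
`h = +∞`) on `∂B_α`, Neumann on the rest of `∂Ω`. -/
def firstEigenvalue {N : ℕ} (h : WithTop ℝ) (α : ℝ) (Ω : Set (EuclideanSpace ℝ (Fin N))) : ℝ :=
  sInf (rayleighValues h α Ω)

end

/-! ### The Sturm–Liouville initial value problem `(ρ v')' = -τ ρ v`, `v b = 1`, `v' b = 0` -/

/-! Write A for the annulus, `ρ r = r ^ (N - 1)`, and let `v` be the radial ground state of A with
eigenvalue `τ`: `(ρ v')' = -τ ρ v`, `v' β = 0`, normalised by `v β = 1`, with the Robin or Dirichlet
condition at `α`. The Neumann condition at `β` makes the extension `w` of `v` by the constant 1 a C¹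
function, so `w` is a test function on Ω as well.

Put `f = |∇w|² - τ w²`. On Ω \ A one has `f = -τ`. On A one has `f > -τ`, because `τ v` is strictly
increasing, whatever the sign of `τ`, so that `τ v² < τ`. As Ω \ A and A \ Ω have the same volume,
passing from A to Ω changes `∫ f` by `-∫_{A \ Ω} (f + τ) ≤ 0`. The energy identity of `v` gives `∫_A
f = -h ∫ w² dS`, so the Rayleigh quotient of `w` on Ω is at most `τ`, and less than `τ` unless A \ Ω
is null (`IsRobinGroundState.exists_rayleighValue`).

It remains to see that `τ` is a lower bound for all Rayleigh quotients on A. On each ray this is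
Jacobi's inequality, a completed square built from a positive solution
(`IsNeumannSolution.mul_integral_sq_le`). Polar coordinates give it for C¹ functions, and the
definition of the trace carries it to H¹ (`IsRobinGroundState.mul_setIntegral_sq_le`).

If equality holds, A \ Ω and hence Ω \ A are null. The Lipschitz boundary excludes slits and
punctures, so A ⊆ Ω; openness of Ω gives the other inclusion. -/

theorem hasDerivAt_integral_lower {f : ℝ → ℝ} (hf : Continuous f) (b r : ℝ) :
    HasDerivAt (fun s => ∫ t in s..b, f t) (-f r) r :=
  intervalIntegral.integral_hasDerivAt_left (hf.intervalIntegrable _ _)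
    hf.aestronglyMeasurable.stronglyMeasurableAtFilter hf.continuousAt

theorem continuous_integral_lower {f : ℝ → ℝ} (hf : Continuous f) (b : ℝ) :
    Continuous fun s => ∫ t in s..b, f t :=
  continuous_iff_continuousAt.2 fun r => (hasDerivAt_integral_lower hf b r).continuousAt

/-- The coefficients of the expansion in powers of `-τ` of the solution of `(ρ v')' = -τ ρ v`,
`v b = 1`, `v' b = 0` on `[a, b]`, extended by constants. -/
noncomputable def volterraIterate (ρ : ℝ → ℝ) (a b : ℝ) : ℕ → ℝ → ℝ
  | 0 => fun _ => 1
  | k + 1 => fun r =>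
      ∫ s in (max a (min r b))..b, (∫ t in s..b, ρ t * volterraIterate ρ a b k t) / ρ s

theorem continuous_volterraIterate {ρ : ℝ → ℝ} (hρ : Continuous ρ) (hpos : ∀ r, 0 < ρ r)
    (a b : ℝ) (k : ℕ) : Continuous (volterraIterate ρ a b k) := by
  induction k with
  | zero => exact continuous_const
  | succ k ih =>
    have h1 : Continuous fun s => (∫ t in s..b, ρ t * volterraIterate ρ a b k t) / ρ s :=
      (continuous_integral_lower (hρ.mul ih) b).div hρ fun s => (hpos s).ne'
    exact (continuous_integral_lower h1 b).comp
      (continuous_const.max (continuous_id.min continuous_const))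

theorem volterraIterate_nonneg {ρ : ℝ → ℝ} (hpos : ∀ r, 0 < ρ r) {a b : ℝ} (hab : a ≤ b)
    (k : ℕ) {r : ℝ} (hr : r ≤ b) : 0 ≤ volterraIterate ρ a b k r := by
  induction k generalizing r with
  | zero => exact zero_le_one
  | succ k ih =>
    refine intervalIntegral.integral_nonneg (by simp [hab]) fun s hs => ?_
    refine div_nonneg (intervalIntegral.integral_nonneg hs.2 fun t ht => ?_) (hpos s).le
    exact mul_nonneg (hpos t).le (ih ht.2)

/-- Clamping the argument turns bounds on `[a, b]` into bounds on all of ℝ, so the series in `τ` can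
be summed without restricting `r`. -/
theorem volterraIterate_eq_clamp (ρ : ℝ → ℝ) {a b : ℝ} (hab : a ≤ b) (k : ℕ) (r : ℝ) :
    volterraIterate ρ a b k r = volterraIterate ρ a b k (max a (min r b)) := by
  cases k with
  | zero => rfl
  | succ k =>
    have : max a (min (max a (min r b)) b) = max a (min r b) := by
      rw [min_eq_left (max_le hab (min_le_right _ _)), max_eq_right (le_max_left _ _)]
    simp only [volterraIterate, this]

/-- Each iteration multiplies the bound at `s` by at most `(b - s) M / m ≤ D`, and the outer
integration of `(b - s) ^ k` produces the factorial that makes the series converge for every `τ`. -/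
theorem volterraIterate_le {ρ : ℝ → ℝ} (hρ : Continuous ρ) (hpos : ∀ r, 0 < ρ r)
    {a b m M : ℝ} (hab : a ≤ b) (hm : 0 < m) (hmρ : ∀ r ∈ Set.Icc a b, m ≤ ρ r)
    (hMρ : ∀ r ∈ Set.Icc a b, ρ r ≤ M) (k : ℕ) {r : ℝ} (hr : r ∈ Set.Icc a b) :
    volterraIterate ρ a b k r ≤ (M / m * (b - a) * (b - r)) ^ k / k.factorial := by
  have hM : 0 < M := (hpos a).trans_le (hMρ a ⟨le_rfl, hab⟩)
  set D := M / m * (b - a) with hD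
  have hD0 : 0 ≤ D := mul_nonneg (by positivity) (by linarith)
  induction k generalizing r with
  | zero => simp [volterraIterate]
  | succ k ih =>
    have hc := continuous_volterraIterate hρ hpos a b k
    have hr' : max a (min r b) = r := by rw [min_eq_left hr.2, max_eq_right hr.1]
    have key : ∀ s ∈ Set.Icc r b, (∫ t in s..b, ρ t * volterraIterate ρ a b k t) / ρ s ≤
        D * ((D * (b - s)) ^ k / k.factorial) := by
      intro s hs
      have hsa : s ∈ Set.Icc a b := ⟨hr.1.trans hs.1, hs.2⟩
      have hbs : 0 ≤ b - s := by linarith [hs.2]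
      have h1 : ∫ t in s..b, ρ t * volterraIterate ρ a b k t ≤
          ∫ _ in s..b, M * ((D * (b - s)) ^ k / k.factorial) := by
        refine intervalIntegral.integral_mono_on hs.2 ((hρ.mul hc).intervalIntegrable _ _)
          (by simp) fun t ht => ?_
        have hta : t ∈ Set.Icc a b := ⟨hsa.1.trans ht.1, ht.2⟩
        have hbt : 0 ≤ b - t := by linarith [ht.2]
        refine mul_le_mul (hMρ t hta) ((ih hta).trans ?_)
          (volterraIterate_nonneg hpos hab k ht.2) hM.le
        have : D * (b - t) ≤ D * (b - s) := by gcongr; exact ht.1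
        have h0 : 0 ≤ D * (b - t) := by positivity
        gcongr
      rw [intervalIntegral.integral_const, smul_eq_mul] at h1
      rw [div_le_iff₀ (hpos s)]
      refine h1.trans ?_
      have hX : 0 ≤ (D * (b - s)) ^ k / k.factorial := by positivity
      have h2 : (b - s) * M ≤ D * ρ s := by
        calc (b - s) * M ≤ (b - a) * M := by gcongr; exact hsa.1
          _ = D * m := by rw [hD]; field_simp
          _ ≤ D * ρ s := by gcongr; exact hmρ s hsa
      nlinarith [mul_le_mul_of_nonneg_right h2 hX]
    have hcont : Continuous fun s => (∫ t in s..b, ρ t * volterraIterate ρ a b k t) / ρ s :=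
      (continuous_integral_lower (hρ.mul hc) b).div hρ fun s => (hpos s).ne'
    have hcont2 : Continuous fun s => D * ((D * (b - s)) ^ k / k.factorial) := by fun_prop
    simp only [volterraIterate, hr']
    refine (intervalIntegral.integral_mono_on hr.2 (hcont.intervalIntegrable _ _)
      (hcont2.intervalIntegrable _ _) key).trans_eq ?_
    have hder : ∀ s ∈ Set.uIcc r b,
        HasDerivAt (fun s => -((D * (b - s)) ^ (k + 1) / (k + 1).factorial))
          (D * ((D * (b - s)) ^ k / k.factorial)) s := by
      intro s _
      have h := ((((hasDerivAt_id s).const_sub b).const_mul D).pow (k + 1)).div_const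
        ((k + 1).factorial : ℝ) |>.neg
      refine h.congr_deriv ?_
      rw [Nat.factorial_succ]
      have : ((k : ℝ) + 1) ≠ 0 := by positivity
      have : (k.factorial : ℝ) ≠ 0 := by positivity
      push_cast
      simp only [id]
      field_simp
    rw [intervalIntegral.integral_eq_sub_of_hasDerivAt hder (hcont2.intervalIntegrable _ _)]
    simp

/-- The solutions `v τ` of `(ρ v')' = -τ ρ v`, `v b = 1`, `v' b = 0`, written as an integral
equation; they depend continuously on `τ`. -/
theorem exists_sturmLiouville_family {ρ : ℝ → ℝ} (hρ : Continuous ρ) (hpos : ∀ r, 0 < ρ r)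
    {a b : ℝ} (hab : a < b) :
    ∃ v : ℝ → ℝ → ℝ, Continuous (Function.uncurry v) ∧
      (∀ τ ≤ 0, ∀ r ∈ Set.Icc a b, 1 ≤ v τ r) ∧
      ∀ τ, ∀ r ∈ Set.Icc a b,
        v τ r = 1 - ∫ s in r..b, (τ * ∫ t in s..b, ρ t * v τ t) / ρ s := by
  obtain ⟨x, hx, hxm⟩ := isCompact_Icc.exists_isMinOn (Set.nonempty_Icc.2 hab.le) hρ.continuousOn
  obtain ⟨y, hy, hyM⟩ := isCompact_Icc.exists_isMaxOn (Set.nonempty_Icc.2 hab.le) hρ.continuousOn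
  set w := volterraIterate ρ a b with hw
  have hwc : ∀ k, Continuous (w k) := continuous_volterraIterate hρ hpos a b
  set L := ρ y / ρ x * (b - a) * (b - a) with hL
  have hquot : 0 < ρ y / ρ x := div_pos (hpos y) (hpos x)
  have hba : 0 < b - a := sub_pos.2 hab
  have hL0 : 0 ≤ L := by positivity
  have hclamp : ∀ r, max a (min r b) ∈ Set.Icc a b :=
    fun r => ⟨le_max_left _ _, max_le hab.le (min_le_right _ _)⟩
  have hwb : ∀ k r, ‖w k r‖ ≤ L ^ k / k.factorial := by
    intro k r
    rw [hw, volterraIterate_eq_clamp ρ hab.le]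
    have hc := hclamp r
    rw [Real.norm_of_nonneg (volterraIterate_nonneg hpos hab.le k hc.2)]
    refine (volterraIterate_le hρ hpos hab.le (hpos x) (fun r hr => hxm hr)
      (fun r hr => hyM hr) k hc).trans ?_
    have h0 : 0 ≤ b - max a (min r b) := by linarith [hc.2]
    have : b - max a (min r b) ≤ b - a := by linarith [hc.1]
    rw [hL]
    gcongr
  have hterm : ∀ τ k r, ‖(-τ) ^ k * w k r‖ ≤ (|τ| * L) ^ k / k.factorial := by
    intro τ k r
    rw [norm_mul, norm_pow, norm_neg, Real.norm_eq_abs, mul_pow, mul_div_assoc]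
    gcongr
    exact hwb k r
  have hsum : ∀ τ r, Summable fun k => (-τ) ^ k * w k r := fun τ r =>
    Summable.of_norm_bounded (Real.summable_pow_div_factorial _) (hterm τ · r)
  set v : ℝ → ℝ → ℝ := fun τ r => ∑' k, (-τ) ^ k * w k r with hv
  have hvc : Continuous (Function.uncurry v) := by
    refine continuous_iff_continuousAt.2 fun ⟨τ, r⟩ => ?_
    -- The series is dominated uniformly only for bounded `τ`, so continuity is proved on a strip
    -- around the given point.
    have hopen : IsOpen {q : ℝ × ℝ | |q.1| < |τ| + 1} :=
      isOpen_lt (by fun_prop) continuous_const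
    refine (continuousOn_tsum (f := fun k (q : ℝ × ℝ) => (-q.1) ^ k * w k q.2) (fun k => ?_)
      (Real.summable_pow_div_factorial ((|τ| + 1) * L)) fun k q hq => ?_).continuousAt
      (hopen.mem_nhds (by simp))
    · exact ((by fun_prop : Continuous fun q : ℝ × ℝ => (-q.1) ^ k).mul
        ((hwc k).comp continuous_snd)).continuousOn
    · refine (hterm q.1 k q.2).trans ?_
      have : |q.1| ≤ |τ| + 1 := le_of_lt hq
      gcongr
  have hvc' : ∀ τ, Continuous (v τ) := fun τ => hvc.comp (by fun_prop : Continuous fun r => (τ, r))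
  have hint1 : ∀ τ s, HasSum (fun k => (-τ) ^ k * ∫ t in s..b, ρ t * w k t)
      (∫ t in s..b, ρ t * v τ t) := by
    intro τ s
    obtain ⟨z, hz, hzM⟩ := (isCompact_uIcc (a := s) (b := b)).exists_isMaxOn Set.nonempty_uIcc
      hρ.continuousOn
    have := intervalIntegral.hasSum_integral_of_dominated_convergence (μ := volume) (a := s) (b := b)
      (F := fun k t => ρ t * ((-τ) ^ k * w k t)) (f := fun t => ρ t * v τ t)
      (fun k _ => ρ z * ((|τ| * L) ^ k / k.factorial))
      (fun k => ((hρ.mul (continuous_const.mul (hwc k))).aestronglyMeasurable))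
      (fun k => .of_forall fun t ht => ?_)
      (.of_forall fun t _ => (Real.summable_pow_div_factorial _).mul_left _)
      (by simp) (.of_forall fun t _ => (hsum τ t).hasSum.mul_left _)
    · refine Eq.mp (congrArg (HasSum · _) (funext fun k => ?_)) this
      rw [← intervalIntegral.integral_const_mul]
      exact intervalIntegral.integral_congr fun t _ => by ring
    · rw [norm_mul, Real.norm_of_nonneg (hpos t).le]
      exact mul_le_mul (hzM (Set.uIoc_subset_uIcc ht)) (hterm τ k t) (norm_nonneg _) (hpos z).le
  have hbk : ∀ k, Continuous fun s => ∫ t in s..b, ρ t * w k t :=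
    fun k => continuous_integral_lower (hρ.mul (hwc k)) b
  have hint2 : ∀ τ, ∀ r ∈ Set.Icc a b, HasSum (fun k => (-τ) ^ k * w (k + 1) r)
      (∫ s in r..b, (∫ t in s..b, ρ t * v τ t) / ρ s) := by
    intro τ r hr
    have hr' : max a (min r b) = r := by rw [min_eq_left hr.2, max_eq_right hr.1]
    have := intervalIntegral.hasSum_integral_of_dominated_convergence (μ := volume) (a := r) (b := b)
      (F := fun k s => ((-τ) ^ k * ∫ t in s..b, ρ t * w k t) / ρ s)
      (f := fun s => (∫ t in s..b, ρ t * v τ t) / ρ s)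
      (fun k _ => ((b - a) * ρ y / ρ x) * ((|τ| * L) ^ k / k.factorial))
      (fun k => ((continuous_const.mul (hbk k)).div hρ
        fun s => (hpos s).ne').aestronglyMeasurable)
      (fun k => .of_forall fun s hs => ?_)
      (.of_forall fun t _ => (Real.summable_pow_div_factorial _).mul_left _)
      (by simp) (.of_forall fun s _ => (hint1 τ s).div_const _)
    · refine Eq.mp (congrArg (HasSum · _) (funext fun k => ?_)) this
      simp only [hw, volterraIterate, hr', mul_div_assoc]
      rw [intervalIntegral.integral_const_mul]
    · rw [Set.uIoc_of_le hr.2] at hs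
      have hsa : s ∈ Set.Icc a b := ⟨hr.1.trans hs.1.le, hs.2⟩
      have h1 : ‖∫ t in s..b, ρ t * w k t‖ ≤ ρ y * (L ^ k / k.factorial) * |b - s| := by
        refine intervalIntegral.norm_integral_le_of_norm_le_const fun t ht => ?_
        rw [Set.uIoc_of_le hs.2] at ht
        rw [norm_mul, Real.norm_of_nonneg (hpos t).le]
        exact mul_le_mul (hyM ⟨hsa.1.trans ht.1.le, ht.2⟩) (hwb k t) (norm_nonneg _) (hpos y).le
      rw [abs_of_nonneg (by linarith [hs.2])] at h1
      rw [norm_div, norm_mul, norm_pow, norm_neg, Real.norm_eq_abs, Real.norm_of_nonneg (hpos s).le]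
      have h2 : ρ x ≤ ρ s := hxm hsa
      have h3 : b - s ≤ b - a := by linarith [hsa.1]
      calc |τ| ^ k * ‖∫ t in s..b, ρ t * w k t‖ / ρ s
          ≤ |τ| ^ k * (ρ y * (L ^ k / k.factorial) * (b - a)) / ρ x := by
            have := hpos x
            have := hpos y
            gcongr
            exact h1.trans (by gcongr)
        _ = _ := by rw [mul_pow |τ| L]; ring
  refine ⟨v, hvc, fun τ hτ r hr => ?_, fun τ r hr => ?_⟩
  -- For `τ ≤ 0` all terms are nonnegative, so the sum is at least its zeroth term, 1.
  · have h := (hsum τ r).le_tsum 0 fun k _ => mul_nonneg (pow_nonneg (by linarith) k)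
      (volterraIterate_nonneg hpos hab.le k hr.2)
    simpa [hw, volterraIterate] using h
  · simp only [mul_div_assoc]
    rw [intervalIntegral.integral_const_mul, ← (hint2 τ r hr).tsum_eq, ← tsum_mul_left]
    rw [hv]
    simp only []
    rw [(hsum τ r).tsum_eq_zero_add]
    simp only [pow_zero, hw, volterraIterate, one_mul, pow_succ]
    rw [sub_eq_add_neg, ← tsum_neg]
    congr 2
    ext k
    ring

/-- `v` solves `(ρ v')' = -τ ρ v` on `[a, b]` with `v b = 1` and `v' b = 0`, where `p = ρ v'`. -/
structure IsNeumannSolution (ρ : ℝ → ℝ) (a b τ : ℝ) (v p : ℝ → ℝ) : Prop where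
  hasDerivAt_v : ∀ r, HasDerivAt v (p r / ρ r) r
  continuous_p : Continuous p
  hasDerivAt_p : ∀ r ∈ Set.Icc a b, HasDerivAt p (-τ * ρ r * v r) r
  v_right : v b = 1
  p_eq : ∀ r, r ∈ Set.Icc a b → p r = τ * ∫ t in r..b, ρ t * v t

/-! ### Jacobi's inequality, energy and monotonicity of the Neumann solutions -/

namespace IsNeumannSolution

variable {ρ : ℝ → ℝ} {a b τ : ℝ} {v p : ℝ → ℝ}

theorem continuous_v (h : IsNeumannSolution ρ a b τ v p) : Continuous v :=
  continuous_iff_continuousAt.2 fun r => (h.hasDerivAt_v r).continuousAt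

theorem p_right (h : IsNeumannSolution ρ a b τ v p) (hab : a ≤ b) : p b = 0 := by
  simp [h.p_eq b ⟨hab, le_rfl⟩]

/-- Jacobi's lower bound for the quadratic form by means of a positive solution. -/
theorem mul_integral_sq_le (h : IsNeumannSolution ρ a b τ v p) (hρ : Continuous ρ)
    (hpos : ∀ r, 0 < ρ r) (hab : a ≤ b) (hv : ∀ r ∈ Set.Icc a b, 0 < v r)
    {φ φ' : ℝ → ℝ} (hφ' : Continuous φ') (hφ : ∀ r, HasDerivAt φ (φ' r) r) :
    τ * ∫ r in a..b, ρ r * φ r ^ 2 ≤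
      (∫ r in a..b, ρ r * φ' r ^ 2) + p a / v a * φ a ^ 2 := by
  have hφc : Continuous φ := continuous_iff_continuousAt.2 fun r => (hφ r).continuousAt
  have hder : ∀ r ∈ Set.uIcc a b, HasDerivAt (fun r => φ r ^ 2 * (p r / v r))
      (2 * φ r * φ' r * (p r / v r) + φ r ^ 2 * (-τ * ρ r - (p r / v r) ^ 2 / ρ r)) r := by
    intro r hr
    rw [Set.uIcc_of_le hab] at hr
    have hv0 := (hv r hr).ne'
    have hρ0 := (hpos r).ne'
    refine (((hφ r).pow 2).mul ((h.hasDerivAt_p r hr).div (h.hasDerivAt_v r) hv0)).congr_deriv ?_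
    push_cast
    simp only [pow_one, Pi.pow_apply, Pi.div_apply]
    field_simp
  have hdiv : ContinuousOn (fun r => p r / v r) (Set.uIcc a b) := by
    rw [Set.uIcc_of_le hab]
    exact h.continuous_p.continuousOn.div h.continuous_v.continuousOn fun r hr => (hv r hr).ne'
  have hcont : ContinuousOn (fun r => 2 * φ r * φ' r * (p r / v r) +
      φ r ^ 2 * (-τ * ρ r - (p r / v r) ^ 2 / ρ r)) (Set.uIcc a b) := by
    refine ((by fun_prop : Continuous fun r => 2 * φ r * φ' r).continuousOn.mul hdiv).add
      ((hφc.pow 2).continuousOn.mul ((by fun_prop : Continuous fun r => -τ * ρ r).continuousOn.sub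
        ((hdiv.pow 2).div hρ.continuousOn fun r _ => (hpos r).ne')))
  have hftc := intervalIntegral.integral_eq_sub_of_hasDerivAt hder hcont.intervalIntegrable
  rw [h.p_right hab] at hftc
  have i1 : IntervalIntegrable (fun r => ρ r * φ r ^ 2) volume a b :=
    (by fun_prop : Continuous fun r => ρ r * φ r ^ 2).intervalIntegrable _ _
  have i2 : IntervalIntegrable (fun r => ρ r * φ' r ^ 2) volume a b :=
    (by fun_prop : Continuous fun r => ρ r * φ' r ^ 2).intervalIntegrable _ _
  have hmono := intervalIntegral.integral_mono_on hab hcont.intervalIntegrable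
    (i2.sub (i1.const_mul τ)) fun r hr => by
      have hρ0 := hpos r
      -- The quotient `y = p / v` solves the Riccati equation `y' = -τ ρ - y² / ρ`; hence `ρ φ'² - τ
      -- ρ φ² - (φ² y)'` is a perfect square.
      have : 0 ≤ ρ r * (φ' r - φ r * (p r / v r) / ρ r) ^ 2 := by positivity
      have e : ρ r * (φ' r - φ r * (p r / v r) / ρ r) ^ 2 = ρ r * φ' r ^ 2 - τ * (ρ r * φ r ^ 2) -
          (2 * φ r * φ' r * (p r / v r) + φ r ^ 2 * (-τ * ρ r - (p r / v r) ^ 2 / ρ r)) := by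
        field_simp
        ring
      linarith
  rw [hftc, intervalIntegral.integral_sub i2 (i1.const_mul τ),
    intervalIntegral.integral_const_mul, zero_div, mul_zero, zero_sub] at hmono
  linarith

/-- The energy identity. -/
theorem integral_energy (h : IsNeumannSolution ρ a b τ v p) (hρ : Continuous ρ)
    (hpos : ∀ r, 0 < ρ r) (hab : a ≤ b) :
    (∫ r in a..b, ρ r * (p r / ρ r) ^ 2) + p a * v a = τ * ∫ r in a..b, ρ r * v r ^ 2 := by
  have hvc := h.continuous_v
  have hpc := h.continuous_p
  have hder : ∀ r ∈ Set.uIcc a b, HasDerivAt (fun r => p r * v r)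
      (ρ r * (p r / ρ r) ^ 2 - τ * (ρ r * v r ^ 2)) r := by
    intro r hr
    rw [Set.uIcc_of_le hab] at hr
    refine ((h.hasDerivAt_p r hr).mul (h.hasDerivAt_v r)).congr_deriv ?_
    have := (hpos r).ne'
    field_simp
    ring
  have i1 : IntervalIntegrable (fun r => ρ r * v r ^ 2) volume a b :=
    (by fun_prop : Continuous fun r => ρ r * v r ^ 2).intervalIntegrable _ _
  have i2 : IntervalIntegrable (fun r => ρ r * (p r / ρ r) ^ 2) volume a b :=
    (hρ.mul ((hpc.div hρ fun r => (hpos r).ne').pow 2)).intervalIntegrable _ _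
  have := intervalIntegral.integral_eq_sub_of_hasDerivAt hder (i2.sub (i1.const_mul τ))
  rw [intervalIntegral.integral_sub i2 (i1.const_mul τ), intervalIntegral.integral_const_mul,
    h.p_right hab] at this
  linarith

theorem integral_mul_pos (h : IsNeumannSolution ρ a b τ v p) (hρ : Continuous ρ)
    (hpos : ∀ r, 0 < ρ r) (hv : ∀ r ∈ Set.Icc a b, 0 ≤ v r) {r : ℝ} (hr : r ∈ Set.Ico a b) :
    0 < ∫ t in r..b, ρ t * v t :=
  intervalIntegral.integral_pos hr.2 (hρ.mul h.continuous_v).continuousOn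
    (fun t ht => mul_nonneg (hpos t).le (hv t ⟨hr.1.trans ht.1.le, ht.2⟩))
    ⟨b, ⟨hr.2.le, le_rfl⟩, by simpa [h.v_right] using hpos b⟩

/-- The factor `τ` makes one statement serve both signs: `τ p` is `τ²` times a positive integral. -/
theorem mul_p_pos (h : IsNeumannSolution ρ a b τ v p) (hρ : Continuous ρ)
    (hpos : ∀ r, 0 < ρ r) (hτ : τ ≠ 0) (hv : ∀ r ∈ Set.Icc a b, 0 ≤ v r) {r : ℝ}
    (hr : r ∈ Set.Ico a b) : 0 < τ * p r := by
  rw [h.p_eq r ⟨hr.1, hr.2.le⟩, ← mul_assoc]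
  exact mul_pos (mul_self_pos.2 hτ) (h.integral_mul_pos hρ hpos hv hr)

theorem sub_eq_integral (h : IsNeumannSolution ρ a b τ v p) (hρ : Continuous ρ)
    (hpos : ∀ r, 0 < ρ r) (r s : ℝ) : v s - v r = ∫ t in r..s, p t / ρ t :=
  (intervalIntegral.integral_eq_sub_of_hasDerivAt (fun t _ => h.hasDerivAt_v t)
    ((h.continuous_p.div hρ fun t => (hpos t).ne').intervalIntegrable _ _)).symm

/-- `τ v` is strictly increasing when `v` is nonnegative. -/
theorem mul_lt_mul (h : IsNeumannSolution ρ a b τ v p) (hρ : Continuous ρ)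
    (hpos : ∀ r, 0 < ρ r) (hτ : τ ≠ 0) (hv : ∀ r ∈ Set.Icc a b, 0 ≤ v r) {r s : ℝ}
    (hr : a ≤ r) (hrs : r < s) (hs : s ≤ b) : τ * v r < τ * v s := by
  have e := h.sub_eq_integral hρ hpos r s
  have hc : Continuous fun t => p t / ρ t := h.continuous_p.div hρ fun t => (hpos t).ne'
  have : 0 < ∫ t in r..s, τ * (p t / ρ t) := by
    refine intervalIntegral.integral_pos hrs (continuous_const.mul hc).continuousOn
      (fun t ht => ?_) ⟨r, ⟨le_rfl, hrs.le⟩, ?_⟩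
    · rw [← mul_div_assoc]
      refine div_nonneg ?_ (hpos t).le
      rcases (ht.2.trans hs).lt_or_eq with h' | rfl
      · exact (h.mul_p_pos hρ hpos hτ hv ⟨hr.trans ht.1.le, h'⟩).le
      · rw [h.p_right (hr.trans ht.1.le), mul_zero]
    · rw [← mul_div_assoc]
      exact div_pos (h.mul_p_pos hρ hpos hτ hv ⟨hr, hrs.trans_le hs⟩) (hpos r)
  rw [intervalIntegral.integral_const_mul, ← e] at this
  linarith

end IsNeumannSolution

/-- A family of solutions depending continuously on `τ`. -/
theorem exists_neumannSolution_family {ρ : ℝ → ℝ} (hρ : Continuous ρ) (hpos : ∀ r, 0 < ρ r)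
    {a b : ℝ} (hab : a < b) :
    ∃ v p : ℝ → ℝ → ℝ, (∀ τ, IsNeumannSolution ρ a b τ (v τ) (p τ)) ∧
      ContinuousOn (Function.uncurry v) (Set.univ ×ˢ Set.Icc a b) ∧ (Continuous fun τ => p τ a) ∧
      ∀ τ ≤ 0, ∀ r ∈ Set.Icc a b, 1 ≤ v τ r := by
  obtain ⟨w, hwc, hw1, hweq⟩ := exists_sturmLiouville_family hρ hpos hab
  have hwc' : ∀ τ, Continuous (w τ) := fun τ => hwc.comp (by fun_prop : Continuous fun r => (τ, r))
  have hint : ∀ τ, Continuous fun s => τ * ∫ t in s..b, ρ t * w τ t := fun τ =>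
    continuous_const.mul (continuous_integral_lower (hρ.mul (hwc' τ)) b)
  have hquot : ∀ τ, Continuous fun s => (τ * ∫ t in s..b, ρ t * w τ t) / ρ s := fun τ =>
    (hint τ).div hρ fun s => (hpos s).ne'
  -- Taking the right-hand side of the integral equation as `v` makes it differentiable on all of ℝ.
  -- It agrees with `w` only on `[a, b]`, which is why the equation for `p` is restricted to that
  -- interval.
  refine ⟨fun τ r => 1 - ∫ s in r..b, (τ * ∫ t in s..b, ρ t * w τ t) / ρ s,
    fun τ r => τ * ∫ t in r..b, ρ t * w τ t, fun τ => ⟨fun r => ?_, hint τ, fun r hr => ?_, by simp,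
      fun r hr => ?_⟩, ?_, ?_, ?_⟩
  · exact ((hasDerivAt_integral_lower (hquot τ) b r).const_sub 1).congr_deriv (neg_neg _)
  · refine ((hasDerivAt_integral_lower (hρ.mul (hwc' τ)) b r).const_mul τ).congr_deriv ?_
    simp only [← hweq τ r hr, Pi.mul_apply]
    ring
  · simp only []
    congr 1
    refine intervalIntegral.integral_congr fun t ht => ?_
    rw [Set.uIcc_of_le hr.2] at ht
    simp only [← hweq τ t ⟨hr.1.trans ht.1, ht.2⟩]
  · exact hwc.continuousOn.congr fun q hq => (hweq q.1 q.2 hq.2).symm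
  · exact continuous_id.mul (intervalIntegral.continuous_parametric_intervalIntegral_of_continuous'
      (f := fun τ t => ρ t * w τ t) ((hρ.comp continuous_snd).mul hwc) a b)
  · intro τ hτ r hr
    simpa only [← hweq τ r hr] using hw1 τ hτ r hr

/-- The first eigenfunction of the weighted one-dimensional problem with a Robin condition
(Dirichlet for `h = ⊤`) at `a` and the Neumann condition at `b`, and its variational property. -/
structure IsRobinGroundState (ρ : ℝ → ℝ) (a b : ℝ) (h : WithTop ℝ) (τ : ℝ) (v p : ℝ → ℝ) :
    Prop extends IsNeumannSolution ρ a b τ v p where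
  pos : ∀ r ∈ Set.Ioc a b, 0 < v r
  nonneg_left : 0 ≤ v a
  ne_zero : τ ≠ 0
  dirichlet : h = ⊤ → v a = 0
  robin : p a * v a = h.untopD 0 * ρ a * v a ^ 2
  neg_of_neg : h < 0 → τ < 0
  lower_bound : ∀ σ < τ, ∃ c : ℝ, (h ≠ ⊤ → c = h.untopD 0 * ρ a) ∧
    ∀ φ φ' : ℝ → ℝ, Continuous φ' → (∀ r, HasDerivAt φ (φ' r) r) →
      σ * ∫ r in a..b, ρ r * φ r ^ 2 ≤ (∫ r in a..b, ρ r * φ' r ^ 2) + c * φ a ^ 2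

/-! ### Existence of the one-dimensional ground state -/

theorem integral_weight_sq_nonneg {ρ : ℝ → ℝ} (hpos : ∀ r, 0 < ρ r) {a b : ℝ} (hab : a ≤ b)
    (φ : ℝ → ℝ) : 0 ≤ ∫ r in a..b, ρ r * φ r ^ 2 :=
  intervalIntegral.integral_nonneg hab fun r _ => mul_nonneg (hpos r).le (sq_nonneg _)

/-- For `τ ≤ 0` the solutions satisfy `v ≥ 1`, so positivity is free and only the Robin condition
must be met. The defect `p a - h ρ(a) v a` is positive at `τ = 0` and nonpositive for very negative
`τ`; the intermediate value theorem gives a zero. -/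
theorem exists_robinGroundState_of_neg {ρ : ℝ → ℝ} (hρ : Continuous ρ) (hpos : ∀ r, 0 < ρ r)
    {a b : ℝ} (hab : a < b) {h : ℝ} (hh : h < 0) :
    ∃ τ v p, IsRobinGroundState ρ a b (h : WithTop ℝ) τ v p := by
  obtain ⟨v, p, hsol, hvc, hpc, hv1⟩ := exists_neumannSolution_family hρ hpos hab
  have haI : a ∈ Set.Icc a b := ⟨le_rfl, hab.le⟩
  have hva : Continuous fun τ => v τ a :=
    continuousOn_univ.1 (hvc.comp (f := fun τ : ℝ => (τ, a)) (by fun_prop) fun τ _ => ⟨trivial, haI⟩)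
  obtain ⟨x, hx, hxm⟩ := isCompact_Icc.exists_isMinOn (Set.nonempty_Icc.2 hab.le) hρ.continuousOn
  set m := ρ x
  have hm : 0 < m := hpos x
  have hρa := hpos a
  -- If `p a > h ρ(a) v a`, then `v` falls by at most `v a / 2` on `[a, a + δ]`. This keeps `∫ ρ v`
  -- at least `δ m v a / 2`, and `σ` below is so negative that `p a = σ ∫ ρ v` contradicts the
  -- assumption.
  obtain ⟨δ, hδ0, hδb, hδ⟩ : ∃ δ > 0, a + δ ≤ b ∧ δ * (-h * ρ a) ≤ m / 2 := by
    have hk : 0 < -h * ρ a := by nlinarith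
    refine ⟨min (b - a) (m / 2 / (-h * ρ a)), lt_min (by linarith) (by positivity), ?_, ?_⟩
    · linarith [min_le_left (b - a) (m / 2 / (-h * ρ a))]
    · rw [← le_div_iff₀ hk]
      exact min_le_right _ _
  obtain ⟨σ, hσ0, hσ⟩ : ∃ σ < 0, -h * ρ a ≤ -σ * (δ * m / 2) :=
    ⟨-(-h * ρ a / (δ * m / 2)), by
      have : 0 < -h * ρ a / (δ * m / 2) := div_pos (by nlinarith) (by positivity)
      linarith, by rw [neg_neg, div_mul_cancel₀ _ (by positivity)]⟩
  have hvpos : ∀ τ ≤ 0, ∀ r ∈ Set.Icc a b, 0 < v τ r := fun τ hτ r hr =>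
    zero_lt_one.trans_le (hv1 τ hτ r hr)
  have hσle : p σ a ≤ h * ρ a * v σ a := by
    by_contra! hcon
    have hs := hsol σ
    have hv0 : ∀ r ∈ Set.Icc a b, 0 ≤ v σ r := fun r hr => (hvpos σ hσ0.le r hr).le
    have hanti : ∀ r s, a ≤ r → r ≤ s → s ≤ b → v σ s ≤ v σ r := by
      intro r s hr hrs hsb
      rcases hrs.lt_or_eq with h' | rfl
      · have := hs.mul_lt_mul hρ hpos hσ0.ne hv0 hr h' hsb
        nlinarith
      · exact le_rfl
    have hpc' := hs.continuous_p
    have hvc' := hs.continuous_v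
    have hρv : Continuous fun t => ρ t * v σ t := hρ.mul hvc'
    have hpa : ∀ r ∈ Set.Icc a b, p σ a ≤ p σ r := by
      intro r hr
      rw [hs.p_eq a haI, hs.p_eq r hr]
      refine mul_le_mul_of_nonpos_left ?_ hσ0.le
      rw [← intervalIntegral.integral_add_adjacent_intervals (b := r)
        (hρv.intervalIntegrable a r) (hρv.intervalIntegrable r b)]
      have : 0 ≤ ∫ t in a..r, ρ t * v σ t := intervalIntegral.integral_nonneg hr.1
        fun t ht => mul_nonneg (hpos t).le (hv0 t ⟨ht.1, ht.2.trans hr.2⟩)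
      linarith
    have hpneg : p σ a ≤ 0 := by
      have := hs.mul_p_pos hρ hpos hσ0.ne hv0 (r := a) ⟨le_rfl, hab⟩
      nlinarith
    have hdrop : v σ a / 2 ≤ v σ (a + δ) := by
      have e := hs.sub_eq_integral hρ hpos a (a + δ)
      have hle : ∫ _ in a..(a + δ), p σ a / m ≤ ∫ t in a..(a + δ), p σ t / ρ t := by
        refine intervalIntegral.integral_mono_on (by linarith) (by simp)
          ((hpc'.div hρ fun t => (hpos t).ne').intervalIntegrable _ _) fun t ht => ?_
        have htI : t ∈ Set.Icc a b := ⟨ht.1, ht.2.trans hδb⟩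
        calc p σ a / m ≤ p σ a / ρ t := by
              rw [div_le_div_iff₀ hm (hpos t)]
              exact mul_le_mul_of_nonpos_left (hxm htI) hpneg
          _ ≤ p σ t / ρ t := div_le_div_of_nonneg_right (hpa t htI) (hpos t).le
      rw [intervalIntegral.integral_const, smul_eq_mul, ← e, add_sub_cancel_left] at hle
      have hva0 := hvpos σ hσ0.le a haI
      have h1 : -(v σ a / 2) ≤ δ * (p σ a / m) := by
        rw [← mul_div_assoc, le_div_iff₀ hm]
        nlinarith [mul_le_mul_of_nonneg_right hδ hva0.le]
      linarith
    have hlow : δ * m * (v σ a / 2) ≤ ∫ t in a..b, ρ t * v σ t := by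
      rw [← intervalIntegral.integral_add_adjacent_intervals (b := a + δ)
        (hρv.intervalIntegrable _ _) (hρv.intervalIntegrable _ _)]
      have h0 : 0 ≤ ∫ t in (a + δ)..b, ρ t * v σ t := intervalIntegral.integral_nonneg hδb
        fun t ht => mul_nonneg (hpos t).le (hv0 t ⟨by linarith [ht.1], ht.2⟩)
      have h1 : ∫ _ in a..(a + δ), m * (v σ a / 2) ≤ ∫ t in a..(a + δ), ρ t * v σ t := by
        refine intervalIntegral.integral_mono_on (by linarith) (by simp)
          (hρv.intervalIntegrable _ _) fun t ht => ?_
        have htI : t ∈ Set.Icc a b := ⟨ht.1, ht.2.trans hδb⟩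
        exact mul_le_mul (hxm htI) (hdrop.trans (hanti t (a + δ) ht.1 ht.2 hδb))
          (by linarith [hv0 a haI]) (hpos t).le
      rw [intervalIntegral.integral_const, smul_eq_mul, add_sub_cancel_left] at h1
      linarith
    have hva0 := hvpos σ hσ0.le a haI
    rw [hs.p_eq a haI] at hcon
    nlinarith [mul_le_mul_of_nonneg_right hσ hva0.le]
  have hzero : p 0 a = 0 := by simp [(hsol 0).p_eq a haI]
  have hv01 := hvpos 0 le_rfl a haI
  obtain ⟨τ, hτ, hτ0⟩ : (0 : ℝ) ∈ (fun τ => p τ a - h * ρ a * v τ a) '' Set.Icc σ 0 :=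
    intermediate_value_Icc hσ0.le (hpc.sub (continuous_const.mul hva)).continuousOn
      ⟨by simpa using hσle, by
        have : h * ρ a * v 0 a < 0 := mul_neg_of_neg_of_pos (by nlinarith) hv01
        show 0 ≤ p 0 a - h * ρ a * v 0 a
        rw [hzero]
        linarith⟩
  replace hτ0 := sub_eq_zero.1 hτ0
  have hτne : τ ≠ 0 := by
    rintro rfl
    rw [hzero] at hτ0
    have : h * ρ a * v 0 a < 0 := mul_neg_of_neg_of_pos (by nlinarith) hv01
    linarith
  have hvτ := hvpos τ hτ.2
  refine ⟨τ, v τ, p τ, ⟨hsol τ, fun r hr => hvτ r ⟨hr.1.le, hr.2⟩, (hvτ a haI).le, hτne, by simp,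
    ?_, fun _ => lt_of_le_of_ne hτ.2 hτne, fun σ' hσ' => ⟨h * ρ a, by simp, fun φ φ' h1 h2 => ?_⟩⟩⟩
  · rw [hτ0, WithTop.untopD_coe]
    ring
  · have := (hsol τ).mul_integral_sq_le hρ hpos hab.le hvτ h1 h2
    rw [hτ0, mul_div_cancel_right₀ _ (hvτ a haI).ne'] at this
    refine le_trans ?_ this
    gcongr
    exact integral_weight_sq_nonneg hpos hab.le φ

/-- Continuation in `τ` from 0: the eigenvalue is the supremum of the parameters for which `v` stays
positive on `[a, b]` and, for finite `h`, `p a ≤ h ρ(a) v a`. At the supremum one of these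
conditions must degenerate, and that is the boundary condition. -/
theorem exists_robinGroundState_of_pos {ρ : ℝ → ℝ} (hρ : Continuous ρ) (hpos : ∀ r, 0 < ρ r)
    {a b : ℝ} (hab : a < b) {h : WithTop ℝ} (hh : 0 < h) :
    ∃ τ v p, IsRobinGroundState ρ a b h τ v p := by
  obtain ⟨v, p, hsol, hvc, hpc, hv1⟩ := exists_neumannSolution_family hρ hpos hab
  have haI : a ∈ Set.Icc a b := ⟨le_rfl, hab.le⟩
  have hvr : ∀ r ∈ Set.Icc a b, Continuous fun τ => v τ r := fun r hr =>
    continuousOn_univ.1 (hvc.comp (f := fun τ : ℝ => (τ, r)) (by fun_prop) fun τ _ => ⟨trivial, hr⟩)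
  set k := h.untopD 0 * ρ a with hk
  have hk0 : h ≠ ⊤ → 0 < k := by
    intro hne
    lift h to ℝ using hne
    exact mul_pos (by simpa using hh) (hpos a)
  set S : Set ℝ := {τ | 0 ≤ τ ∧ (∀ r ∈ Set.Icc a b, 0 < v τ r) ∧ (h ≠ ⊤ → p τ a ≤ k * v τ a)}
    with hS
  have hp0 : p 0 a = 0 := by simp [(hsol 0).p_eq a haI]
  have h0S : (0 : ℝ) ∈ S := ⟨le_rfl, fun r hr => zero_lt_one.trans_le (hv1 0 le_rfl r hr),
    fun hne => by
      rw [hp0]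
      exact mul_nonneg (hk0 hne).le (zero_le_one.trans (hv1 0 le_rfl a haI))⟩
  have hbdd : BddAbove S := by
    -- Jacobi's inequality for `φ r = r - a`, which vanishes at `a`, bounds `S` independently of the
    -- boundary term.
    have hc : Continuous fun r => ρ r * (r - a) ^ 2 := by fun_prop
    have hI : 0 < ∫ r in a..b, ρ r * (r - a) ^ 2 :=
      intervalIntegral.integral_pos hab hc.continuousOn
        (fun r _ => mul_nonneg (hpos r).le (sq_nonneg _))
        ⟨b, ⟨hab.le, le_rfl⟩, mul_pos (hpos b) (by have := sub_pos.2 hab; positivity)⟩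
    refine ⟨(∫ r in a..b, ρ r * 1 ^ 2) / ∫ r in a..b, ρ r * (r - a) ^ 2, fun τ hτ => ?_⟩
    rw [le_div_iff₀ hI]
    have := (hsol τ).mul_integral_sq_le hρ hpos hab.le hτ.2.1 (φ := fun r => r - a)
      (φ' := fun _ => 1) continuous_const fun r => (hasDerivAt_id r).sub_const a
    simpa using this
  set τ := sSup S with hτ
  have hτcl : τ ∈ closure S := csSup_mem_closure ⟨0, h0S⟩ hbdd
  have hτ0 : 0 ≤ τ := le_csSup hbdd h0S
  have hvnn : ∀ r ∈ Set.Icc a b, 0 ≤ v τ r := fun r hr =>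
    closure_minimal (fun σ hσ => (hσ.2.1 r hr).le)
      (isClosed_le continuous_const (hvr r hr)) hτcl
  have hple : h ≠ ⊤ → p τ a ≤ k * v τ a := fun hne =>
    closure_minimal (fun σ hσ => hσ.2.2 hne)
      (isClosed_le hpc (continuous_const.mul (hvr a haI))) hτcl
  have hs := hsol τ
  have hvlt : τ ≠ 0 → ∀ r s, a ≤ r → r < s → s ≤ b → v τ r < v τ s := fun hne r s hr hrs hsb =>
    lt_of_mul_lt_mul_left (hs.mul_lt_mul hρ hpos hne hvnn hr hrs hsb) hτ0
  have hvpos : 0 < v τ a → ∀ r ∈ Set.Icc a b, 0 < v τ r := by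
    intro hva r hr
    rcases eq_or_ne τ 0 with h0 | h0
    · exact zero_lt_one.trans_le (hv1 τ h0.le r hr)
    · rcases hr.1.eq_or_lt with rfl | har
      · exact hva
      · exact hva.trans (hvlt h0 a r le_rfl har hr.2)
  -- If both conditions were strict at the supremum, compactness of `[a, b]` and continuity in `τ`
  -- would keep them valid slightly beyond it.
  have hnotlt : 0 < v τ a → (h ≠ ⊤ → p τ a < k * v τ a) → False := by
    intro hva hlt
    have hev1 : ∀ᶠ σ in 𝓝 τ, ∀ r ∈ Set.Icc a b, 0 < v σ r := by
      have := isCompact_Icc.eventually_forall_of_forall_eventually (x₀ := τ) (K := Set.Icc a b)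
        (P := fun σ r => r ∈ Set.Icc a b → 0 < v σ r) fun r hr => by
          have := (hvc (τ, r) ⟨trivial, hr⟩).eventually (lt_mem_nhds (hvpos hva r hr))
          filter_upwards [eventually_nhdsWithin_iff.1 this] with q hq hqI using hq ⟨trivial, hqI⟩
      exact this.mono fun σ hσ r hr => hσ r hr hr
    have hev2 : ∀ᶠ σ in 𝓝 τ, h ≠ ⊤ → p σ a < k * v σ a := by
      by_cases hne : h = ⊤
      · simp [hne]
      · filter_upwards [(isOpen_lt hpc (continuous_const.mul (hvr a haI))).mem_nhds (hlt hne)]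
          with σ hσ _ using hσ
    obtain ⟨σ, hσ, hσ1, hσ2⟩ := ((eventually_mem_nhdsWithin (a := τ) (s := Set.Ioi τ)).and
      ((hev1.and hev2).filter_mono nhdsWithin_le_nhds)).exists
    rw [Set.mem_Ioi] at hσ
    exact absurd (le_csSup hbdd ⟨hτ0.trans hσ.le, hσ1, fun hne => (hσ2 hne).le⟩) hσ.not_ge
  have hrob : h ≠ ⊤ → 0 < v τ a ∧ p τ a = k * v τ a := by
    intro hne
    -- If `v a = 0`, the closed condition would give `p a ≤ 0`, whereas `τ p a > 0`.
    have hva : 0 < v τ a := by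
      refine lt_of_le_of_ne (hvnn a haI) fun h0 => ?_
      have hne0 : τ ≠ 0 := fun h' => by
        have := hv1 τ h'.le a haI
        linarith
      have h1 := hs.mul_p_pos hρ hpos hne0 hvnn (r := a) ⟨le_rfl, hab⟩
      have h2 := hple hne
      rw [← h0, mul_zero] at h2
      nlinarith
    exact ⟨hva, (hple hne).eq_of_not_lt fun hlt => hnotlt hva fun _ => hlt⟩
  have hdir : h = ⊤ → v τ a = 0 := fun htop => by
    by_contra h0
    exact hnotlt (lt_of_le_of_ne (hvnn a haI) (Ne.symm h0)) fun hne => absurd htop hne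
  have hτne : τ ≠ 0 := by
    intro h0
    by_cases hne : h = ⊤
    · have := hv1 τ h0.le a haI
      linarith [hdir hne]
    · obtain ⟨h1, h2⟩ := hrob hne
      rw [h0, hp0] at h2
      have := mul_pos (hk0 hne) h1
      rw [h0] at this
      linarith
  refine ⟨τ, v τ, p τ, ⟨hs, fun r hr => (hvnn a haI).trans_lt (hvlt hτne a r le_rfl hr.1 hr.2),
    hvnn a haI, hτne, hdir, ?_, fun hneg => absurd hneg hh.not_gt, fun σ hσ => ?_⟩⟩
  · by_cases hne : h = ⊤
    · simp [hdir hne]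
    · rw [(hrob hne).2]
      ring
  · obtain ⟨σ', hσ', hlt⟩ := exists_lt_of_lt_csSup ⟨0, h0S⟩ hσ
    -- In the Dirichlet case `v τ` vanishes at `a` and Jacobi's inequality is not available at `τ`
    -- itself; a parameter `σ'` of `S` above `σ` is used instead, with whatever constant it yields.
    refine ⟨if h = ⊤ then p σ' a / v σ' a else k, fun hne => by simp [hne, hk],
      fun φ φ' h1 h2 => ?_⟩
    split_ifs with hne
    · refine le_trans ?_ ((hsol σ').mul_integral_sq_le hρ hpos hab.le hσ'.2.1 h1 h2)
      gcongr
      exact integral_weight_sq_nonneg hpos hab.le φ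
    · obtain ⟨hva, hpa⟩ := hrob hne
      have := hs.mul_integral_sq_le hρ hpos hab.le (hvpos hva) h1 h2
      rw [hpa, mul_div_cancel_right₀ _ hva.ne'] at this
      refine le_trans ?_ this
      gcongr
      exact integral_weight_sq_nonneg hpos hab.le φ

theorem exists_robinGroundState {ρ : ℝ → ℝ} (hρ : Continuous ρ) (hpos : ∀ r, 0 < ρ r)
    {a b : ℝ} (hab : a < b) {h : WithTop ℝ} (hh : h ≠ 0) :
    ∃ τ v p, IsRobinGroundState ρ a b h τ v p := by
  rcases hh.lt_or_gt with h0 | h0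
  · lift h to ℝ using h0.ne_top
    exact exists_robinGroundState_of_neg hρ hpos hab (by simpa using h0)
  · exact exists_robinGroundState_of_pos hρ hpos hab h0

/-! ### Polar coordinates on annuli -/

theorem integral_volumeIoiPow (n : ℕ) (f : ℝ → ℝ) :
    ∫ r : Set.Ioi (0 : ℝ), f r ∂Measure.volumeIoiPow n = ∫ r in Set.Ioi (0 : ℝ), r ^ n * f r := by
  simp only [Measure.volumeIoiPow, ENNReal.ofReal]
  rw [integral_withDensity_eq_integral_smul ((measurable_subtype_coe.pow_const _).real_toNNReal),
    integral_subtype_comap measurableSet_Ioi fun r => Real.toNNReal (r ^ n) • f r]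
  refine setIntegral_congr_fun measurableSet_Ioi fun r hr => ?_
  rw [NNReal.smul_def, Real.coe_toNNReal _ (pow_nonneg (le_of_lt hr) _), smul_eq_mul]

section Euclidean

variable {N : ℕ}

theorem measurableSet_annulus (a b : ℝ) :
    MeasurableSet (ball (0 : EuclideanSpace ℝ (Fin N)) b \ closedBall 0 a) :=
  measurableSet_ball.diff measurableSet_closedBall

theorem mem_annulus_iff {a b : ℝ} {x : EuclideanSpace ℝ (Fin N)} :
    x ∈ ball (0 : EuclideanSpace ℝ (Fin N)) b \ closedBall 0 a ↔ ‖x‖ ∈ Set.Ioo a b := by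
  simp [and_comm]

theorem Continuous.integrableOn_of_isBounded {F : Type*} [NormedAddCommGroup F]
    {f : EuclideanSpace ℝ (Fin N) → F} (hf : Continuous f)
    {s : Set (EuclideanSpace ℝ (Fin N))} (hs : Bornology.IsBounded s) : IntegrableOn f s :=
  (hf.continuousOn.integrableOn_compact hs.isCompact_closure).mono_set subset_closure

theorem setIntegral_annulus_eq (hN : 2 ≤ N) {f : EuclideanSpace ℝ (Fin N) → ℝ}
    (hf : Continuous f) {a b : ℝ} (ha : 0 < a) (hab : a ≤ b) :
    ∫ x in ball (0 : EuclideanSpace ℝ (Fin N)) b \ closedBall 0 a, f x =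
      ∫ ξ : sphere (0 : EuclideanSpace ℝ (Fin N)) 1,
        (∫ r in a..b, r ^ (N - 1) * f (r • ξ.1)) ∂volume.toSphere := by
  have : Nontrivial (EuclideanSpace ℝ (Fin N)) :=
    Module.nontrivial_of_finrank_pos (R := ℝ) (by rw [finrank_euclideanSpace_fin]; omega)
  set A := ball (0 : EuclideanSpace ℝ (Fin N)) b \ closedBall 0 a with hA
  have hAm : MeasurableSet A := measurableSet_annulus a b
  have hAb : Bornology.IsBounded A := isBounded_ball.subset Set.sdiff_subset
  set F := A.indicator f with hF
  have hFi : Integrable F := (integrable_indicator_iff hAm).2 (hf.integrableOn_of_isBounded hAb)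
  set G : sphere (0 : EuclideanSpace ℝ (Fin N)) 1 × Set.Ioi (0 : ℝ) → ℝ :=
    fun z => F (z.2.1 • z.1.1) with hG
  have hmp := (volume : Measure (EuclideanSpace ℝ (Fin N))).measurePreserving_homeomorphUnitSphereProd
  have hemb := (homeomorphUnitSphereProd (EuclideanSpace ℝ (Fin N))).measurableEmbedding
  have hGF : ∀ x : ({0}ᶜ : Set (EuclideanSpace ℝ (Fin N))),
      G (homeomorphUnitSphereProd (EuclideanSpace ℝ (Fin N)) x) = F x := by
    rintro ⟨x, hx⟩
    have hx' : ‖x‖ ≠ 0 := norm_ne_zero_iff.2 hx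
    simp [hG, homeomorphUnitSphereProd, smul_smul, hx']
  rw [finrank_euclideanSpace_fin] at hmp
  have hGi : Integrable G (volume.toSphere.prod (Measure.volumeIoiPow (N - 1))) := by
    rw [← hmp.integrable_comp_emb hemb]
    have := (integrableOn_iff_comap_subtypeVal (μ := volume)
      (measurableSet_singleton (0 : EuclideanSpace ℝ (Fin N))).compl).1 hFi.integrableOn
    refine this.congr (.of_forall fun x => (hGF x).symm)
  calc ∫ x in A, f x = ∫ x, F x := (integral_indicator hAm).symm
    _ = ∫ x : ({0}ᶜ : Set (EuclideanSpace ℝ (Fin N))), F x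
        ∂((volume : Measure (EuclideanSpace ℝ (Fin N))).comap (↑)) := by
      rw [integral_subtype_comap (measurableSet_singleton _).compl, restrict_compl_singleton]
    _ = ∫ z, G z ∂(volume.toSphere.prod (Measure.volumeIoiPow (N - 1))) := by
      rw [← hmp.integral_comp hemb]
      exact integral_congr_ae (.of_forall fun x => (hGF x).symm)
    _ = ∫ ξ, ∫ r, G (ξ, r) ∂(Measure.volumeIoiPow (N - 1)) ∂volume.toSphere := integral_prod G hGi
    _ = _ := by
      refine integral_congr_ae (.of_forall fun ξ => ?_)
      simp only [hG]
      rw [integral_volumeIoiPow (N - 1) fun r => F (r • ξ.1), intervalIntegral.integral_of_le hab,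
        integral_Ioc_eq_integral_Ioo, ← integral_indicator measurableSet_Ioo,
        ← integral_indicator measurableSet_Ioi]
      congr 1 with r
      have hξ : ‖ξ.1‖ = 1 := by simp
      by_cases hr : 0 < r
      · have hmem : r • ξ.1 ∈ A ↔ r ∈ Set.Ioo a b := by
          rw [hA, mem_annulus_iff, norm_smul, hξ, mul_one, Real.norm_of_nonneg hr.le]
        rw [Set.indicator_of_mem (Set.mem_Ioi.2 hr)]
        by_cases hrA : r ∈ Set.Ioo a b
        · rw [Set.indicator_of_mem hrA, hF, Set.indicator_of_mem (hmem.2 hrA)]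
        · rw [Set.indicator_of_notMem hrA, hF, Set.indicator_of_notMem (hrA ∘ hmem.1), mul_zero]
      · rw [Set.indicator_of_notMem (by simpa using hr),
          Set.indicator_of_notMem fun h => hr (ha.trans h.1)]

theorem integral_sphereSurface {α : ℝ} (hα : 0 ≤ α) {f : EuclideanSpace ℝ (Fin N) → ℝ}
    (hf : Continuous f) :
    ∫ x, f x ∂sphereSurface N α =
      α ^ (N - 1) * ∫ ξ : sphere (0 : EuclideanSpace ℝ (Fin N)) 1, f (α • ξ.1) ∂volume.toSphere := by
  rw [sphereSurface, integral_smul_measure, integral_map (by fun_prop) hf.aestronglyMeasurable,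
    ENNReal.toReal_ofReal (by positivity), smul_eq_mul]

theorem memLp_sphereSurface {α : ℝ} {f : EuclideanSpace ℝ (Fin N) → ℝ} (hf : Continuous f) :
    MemLp f 2 (sphereSurface N α) := by
  refine MemLp.smul_measure ?_ ENNReal.ofReal_ne_top
  rw [memLp_map_measure_iff hf.aestronglyMeasurable (by fun_prop)]
  have hc : Continuous (f ∘ fun z : sphere (0 : EuclideanSpace ℝ (Fin N)) 1 => α • z.1) :=
    hf.comp (by fun_prop)
  obtain ⟨C, hC⟩ := isCompact_univ.exists_bound_of_continuousOn hc.continuousOn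
  exact MemLp.of_bound hc.aestronglyMeasurable C (.of_forall fun z => hC z trivial)

theorem Continuous.memLp_restrict_of_isBounded {F : Type*} [NormedAddCommGroup F]
    {f : EuclideanSpace ℝ (Fin N) → F} (hf : Continuous f)
    {s : Set (EuclideanSpace ℝ (Fin N))} (hs : Bornology.IsBounded s) :
    MemLp f 2 (volume.restrict s) := by
  obtain ⟨C, hC⟩ := hs.isCompact_closure.exists_bound_of_continuousOn hf.continuousOn
  have : IsFiniteMeasure (volume.restrict (closure s)) :=
    ⟨by simpa using hs.isCompact_closure.measure_lt_top⟩
  exact (MemLp.of_bound hf.aestronglyMeasurable C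
    (ae_restrict_of_forall_mem hs.isCompact_closure.measurableSet hC)).mono_measure
    (Measure.restrict_mono subset_closure le_rfl)

theorem continuous_gradient_of_contDiff {w : EuclideanSpace ℝ (Fin N) → ℝ} (hw : ContDiff ℝ 1 w) :
    Continuous (gradient w) :=
  (InnerProductSpace.toDual ℝ (EuclideanSpace ℝ (Fin N))).symm.continuous.comp
    (hw.continuous_fderiv one_ne_zero)

/-- The variational inequality of the radial ground state for functions that are `C¹` up to the
boundary: it holds on each ray. -/
theorem mul_setIntegral_sq_le_of_contDiff (hN : 2 ≤ N) {a b σ c : ℝ} (ha : 0 < a) (hab : a ≤ b)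
    (hlow : ∀ φ φ' : ℝ → ℝ, Continuous φ' → (∀ r, HasDerivAt φ (φ' r) r) →
      σ * ∫ r in a..b, max r a ^ (N - 1) * φ r ^ 2 ≤
        (∫ r in a..b, max r a ^ (N - 1) * φ' r ^ 2) + c * a ^ (N - 1) * φ a ^ 2)
    {w : EuclideanSpace ℝ (Fin N) → ℝ} (hw : ContDiff ℝ 1 w) :
    σ * ∫ x in ball (0 : EuclideanSpace ℝ (Fin N)) b \ closedBall 0 a, w x ^ 2 ≤
      (∫ x in ball (0 : EuclideanSpace ℝ (Fin N)) b \ closedBall 0 a, ‖gradient w x‖ ^ 2) +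
        c * ∫ x, w x ^ 2 ∂sphereSurface N a := by
  have hwc := hw.continuous
  have hgc := continuous_gradient_of_contDiff hw
  have hwc2 : Continuous fun x => w x ^ 2 := hwc.pow 2
  have hgc2 : Continuous fun x => ‖gradient w x‖ ^ 2 := hgc.norm.pow 2
  rw [setIntegral_annulus_eq hN hwc2 ha hab, setIntegral_annulus_eq hN hgc2 ha hab,
    integral_sphereSurface ha.le hwc2]
  have hint : ∀ f : EuclideanSpace ℝ (Fin N) → ℝ, Continuous f →
      Integrable (fun ξ : sphere (0 : EuclideanSpace ℝ (Fin N)) 1 =>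
        ∫ r in a..b, r ^ (N - 1) * f (r • ξ.1)) volume.toSphere := fun f hf =>
    (intervalIntegral.continuous_parametric_intervalIntegral_of_continuous'
      (f := fun (ξ : sphere (0 : EuclideanSpace ℝ (Fin N)) 1) r => r ^ (N - 1) * f (r • ξ.1))
      (by fun_prop) a b).integrable_of_hasCompactSupport (HasCompactSupport.of_compactSpace _)
  have hint2 : Integrable (fun ξ : sphere (0 : EuclideanSpace ℝ (Fin N)) 1 => w (a • ξ.1) ^ 2)
      volume.toSphere :=
    (by fun_prop : Continuous fun ξ : sphere (0 : EuclideanSpace ℝ (Fin N)) 1 =>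
      w (a • ξ.1) ^ 2).integrable_of_hasCompactSupport (HasCompactSupport.of_compactSpace _)
  rw [← integral_const_mul, ← mul_assoc, ← integral_const_mul,
    ← integral_add (hint _ hgc2) (hint2.const_mul _)]
  refine integral_mono ((hint _ hwc2).const_mul _)
    ((hint _ hgc2).add (hint2.const_mul _)) fun ξ => ?_
  have hξ : ‖ξ.1‖ = 1 := by simp
  have hder : ∀ r, HasDerivAt (fun r : ℝ => w (r • ξ.1)) (inner ℝ (gradient w (r • ξ.1)) ξ.1) r := by
    intro r
    have h1 := (hw.differentiable one_ne_zero (r • ξ.1)).hasFDerivAt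
    have h2 : HasDerivAt (fun r : ℝ => r • ξ.1) ξ.1 r := by
      simpa using (hasDerivAt_id r).smul_const ξ.1
    refine (h1.comp_hasDerivAt r h2).congr_deriv ?_
    simp [gradient]
  have hmax : ∀ f : ℝ → ℝ, ∫ r in a..b, max r a ^ (N - 1) * f r = ∫ r in a..b, r ^ (N - 1) * f r := by
    intro f
    refine intervalIntegral.integral_congr fun r hr => ?_
    rw [Set.uIcc_of_le hab] at hr
    simp only [max_eq_left hr.1]
  have h := hlow _ _ (by fun_prop) hder
  rw [hmax fun r => w (r • ξ.1) ^ 2, hmax fun r => inner ℝ (gradient w (r • ξ.1)) ξ.1 ^ 2] at h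
  -- The tangential part of the gradient is dropped.
  refine h.trans (add_le_add ?_ le_rfl)
  have hc1 : Continuous fun r : ℝ => r ^ (N - 1) * inner ℝ (gradient w (r • ξ.1)) ξ.1 ^ 2 := by
    fun_prop
  have hc2 : Continuous fun r : ℝ => r ^ (N - 1) * ‖gradient w (r • ξ.1)‖ ^ 2 := by fun_prop
  refine intervalIntegral.integral_mono_on hab (hc1.intervalIntegrable _ _)
    (hc2.intervalIntegrable _ _) fun r hr => ?_
  have hr0 : 0 < r := ha.trans_le hr.1
  have := abs_real_inner_le_norm (gradient w (r • ξ.1)) ξ.1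
  rw [hξ, mul_one] at this
  exact mul_le_mul_of_nonneg_left (sq_le_sq' (abs_le.1 this).1 (abs_le.1 this).2) (by positivity)

end Euclidean

/-! ### From C¹ functions to H¹ -/

theorem tendsto_integral_norm_sq {X F : Type*} [MeasurableSpace X] {μ : Measure X}
    [NormedAddCommGroup F] {f : X → F} {w : ℕ → X → F} (hf : MemLp f 2 μ)
    (hw : ∀ n, MemLp (w n) 2 μ)
    (hlim : Tendsto (fun n => eLpNorm (fun x => w n x - f x) 2 μ) atTop (𝓝 0)) :
    Tendsto (fun n => ∫ x, ‖w n x‖ ^ 2 ∂μ) atTop (𝓝 (∫ x, ‖f x‖ ^ 2 ∂μ)) := by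
  have key : ∀ g : X → F, MemLp g 2 μ → ∫ x, ‖g x‖ ^ 2 ∂μ = (eLpNorm g 2 μ).toReal ^ 2 := by
    intro g hg
    have := hg.eLpNorm_eq_integral_rpow_norm two_ne_zero ENNReal.ofNat_ne_top
    rw [this]
    simp only [ENNReal.toReal_ofNat, Real.rpow_ofNat]
    have h0 : 0 ≤ ∫ x, ‖g x‖ ^ 2 ∂μ := integral_nonneg fun x => by positivity
    rw [ENNReal.toReal_ofReal (by positivity), ← Real.rpow_natCast, ← Real.rpow_mul h0]
    norm_num
  rw [key f hf]
  simp only [fun n => key (w n) (hw n)]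
  refine Tendsto.pow ?_ 2
  have h := (Lp.tendsto_Lp_iff_tendsto_eLpNorm'' w hw f hf).2 hlim
  simpa [Lp.norm_toLp] using h.norm

section Euclidean

variable {N : ℕ}

/-- The variational inequality of the radial ground state in `H¹`. -/
theorem mul_setIntegral_sq_le_of_isTraceOnSphere (hN : 2 ≤ N) {a b σ c : ℝ} (ha : 0 < a)
    (hab : a ≤ b)
    (hlow : ∀ φ φ' : ℝ → ℝ, Continuous φ' → (∀ r, HasDerivAt φ (φ' r) r) →
      σ * ∫ r in a..b, max r a ^ (N - 1) * φ r ^ 2 ≤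
        (∫ r in a..b, max r a ^ (N - 1) * φ' r ^ 2) + c * a ^ (N - 1) * φ a ^ 2)
    {Ω : Set (EuclideanSpace ℝ (Fin N))}
    (hΩ : ball (0 : EuclideanSpace ℝ (Fin N)) b \ closedBall 0 a ⊆ Ω)
    {u : EuclideanSpace ℝ (Fin N) → ℝ}
    {g : EuclideanSpace ℝ (Fin N) → EuclideanSpace ℝ (Fin N)}
    {T : EuclideanSpace ℝ (Fin N) → ℝ} (hu : MemH1 Ω u g) (hT : IsTraceOnSphere Ω a u g T) :
    σ * ∫ x in ball (0 : EuclideanSpace ℝ (Fin N)) b \ closedBall 0 a, u x ^ 2 ≤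
      (∫ x in ball (0 : EuclideanSpace ℝ (Fin N)) b \ closedBall 0 a, ‖g x‖ ^ 2) +
        c * ∫ x, T x ^ 2 ∂sphereSurface N a := by
  obtain ⟨w, hw, hwu, hwg, hwT⟩ := hT.approx
  set A := ball (0 : EuclideanSpace ℝ (Fin N)) b \ closedBall 0 a
  have hAb : Bornology.IsBounded A := isBounded_ball.subset Set.sdiff_subset
  have hμ : volume.restrict A ≤ volume.restrict Ω := Measure.restrict_mono hΩ le_rfl
  have hsq : ∀ s : ℝ, s ^ 2 = ‖s‖ ^ 2 := fun s => by rw [Real.norm_eq_abs, sq_abs]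
  have t1 := tendsto_integral_norm_sq (hu.memLp.mono_measure hμ)
    (fun n => (hw n).continuous.memLp_restrict_of_isBounded hAb)
    (tendsto_of_tendsto_of_tendsto_of_le_of_le tendsto_const_nhds hwu (fun _ => zero_le)
      fun n => eLpNorm_mono_measure _ hμ)
  have t2 := tendsto_integral_norm_sq (hu.memLp_grad.mono_measure hμ)
    (fun n => (continuous_gradient_of_contDiff (hw n)).memLp_restrict_of_isBounded hAb)
    (tendsto_of_tendsto_of_tendsto_of_le_of_le tendsto_const_nhds hwg (fun _ => zero_le)
      fun n => eLpNorm_mono_measure _ hμ)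
  have t3 := tendsto_integral_norm_sq hT.memLp
    (fun n => memLp_sphereSurface (hw n).continuous) hwT
  simp only [← hsq] at t1 t3
  exact le_of_tendsto_of_tendsto' (t1.const_mul σ) (t2.add (t3.const_mul c)) fun n =>
    mul_setIntegral_sq_le_of_contDiff hN ha hab hlow (hw n)

/-- The inequality is known for `σ < τ` and passes to the limit `σ → τ`. In the Dirichlet case the
constant `c` depends on `σ` without control, but it multiplies the integral of the zero trace. -/
theorem IsRobinGroundState.mul_setIntegral_sq_le (hN : 2 ≤ N) {a b τ : ℝ} {h : WithTop ℝ}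
    {v p : ℝ → ℝ} (ha : 0 < a) (hab : a ≤ b)
    (hs : IsRobinGroundState (fun r => max r a ^ (N - 1)) a b h τ v p)
    {Ω : Set (EuclideanSpace ℝ (Fin N))}
    (hΩ : ball (0 : EuclideanSpace ℝ (Fin N)) b \ closedBall 0 a ⊆ Ω)
    {u : EuclideanSpace ℝ (Fin N) → ℝ}
    {g : EuclideanSpace ℝ (Fin N) → EuclideanSpace ℝ (Fin N)}
    {T : EuclideanSpace ℝ (Fin N) → ℝ} (hu : MemH1 Ω u g) (hT : IsTraceOnSphere Ω a u g T)
    (hT0 : h = ⊤ → T =ᵐ[sphereSurface N a] 0) :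
    τ * ∫ x in ball (0 : EuclideanSpace ℝ (Fin N)) b \ closedBall 0 a, u x ^ 2 ≤
      (∫ x in ball (0 : EuclideanSpace ℝ (Fin N)) b \ closedBall 0 a, ‖g x‖ ^ 2) +
        h.untopD 0 * ∫ x, T x ^ 2 ∂sphereSurface N a := by
  have ha' : a ^ (N - 1) ≠ 0 := by positivity
  have hlt : ∀ σ < τ, σ * ∫ x in ball (0 : EuclideanSpace ℝ (Fin N)) b \ closedBall 0 a, u x ^ 2 ≤
      (∫ x in ball (0 : EuclideanSpace ℝ (Fin N)) b \ closedBall 0 a, ‖g x‖ ^ 2) +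
        h.untopD 0 * ∫ x, T x ^ 2 ∂sphereSurface N a := by
    intro σ hσ
    obtain ⟨c, hc, hlow⟩ := hs.lower_bound σ hσ
    have := mul_setIntegral_sq_le_of_isTraceOnSphere hN (c := c / a ^ (N - 1)) ha hab
      (by simpa only [div_mul_cancel₀ _ ha'] using hlow) hΩ hu hT
    refine this.trans_eq ?_
    congr 1
    by_cases hh : h = ⊤
    · have h0 : ∫ x, T x ^ 2 ∂sphereSurface N a = 0 := by
        rw [integral_congr_ae ((hT0 hh).mono fun x hx => by simp only [hx]; rfl)]
        simp
      rw [h0, mul_zero, mul_zero]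
    · rw [hc hh, max_self, mul_div_cancel_right₀ _ ha']
  have hlim : Tendsto
      (fun σ => σ * ∫ x in ball (0 : EuclideanSpace ℝ (Fin N)) b \ closedBall 0 a, u x ^ 2)
      (𝓝[<] τ)
      (𝓝 (τ * ∫ x in ball (0 : EuclideanSpace ℝ (Fin N)) b \ closedBall 0 a, u x ^ 2)) :=
    ((continuous_id.mul continuous_const).tendsto τ).mono_left nhdsWithin_le_nhds
  exact le_of_tendsto hlim (eventually_nhdsWithin_of_forall hlt)

end Euclidean

/-! ### The radial test function -/

theorem IsNeumannSolution.exists_extension {ρ : ℝ → ℝ} {a b τ : ℝ} {v p : ℝ → ℝ}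
    (h : IsNeumannSolution ρ a b τ v p) (hρ : Continuous ρ) (hpos : ∀ r, 0 < ρ r)
    (ha : 0 < a) (hab : a ≤ b) :
    ∃ ψ q : ℝ → ℝ, Continuous q ∧ (∀ r, HasDerivAt ψ (q r) r) ∧ (∀ r ≤ a / 2, q r = 0) ∧
      (∀ r, b ≤ r → q r = 0) ∧ (∀ r ∈ Set.Icc a b, q r = p r / ρ r) ∧
      (∀ r ∈ Set.Icc a b, ψ r = v r) ∧ ∀ r, b ≤ r → ψ r = 1 := by
  have hpb := h.p_right hab
  -- The first factor is a cutoff, 0 up to `a / 2` and 1 from `a` on, which makes the radial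
  -- function constant near the origin. Beyond `b` the second factor vanishes since `p b = 0`.
  set q : ℝ → ℝ := fun s => max 0 (min 1 (2 * s / a - 1)) * (p (min s b) / ρ s) with hq
  have hqc : Continuous q :=
    (by fun_prop : Continuous fun s => max 0 (min 1 (2 * s / a - 1))).mul
      ((h.continuous_p.comp (by fun_prop)).div hρ fun s => (hpos s).ne')
  have hqb : ∀ r, b ≤ r → q r = 0 := fun r hr => by simp [hq, min_eq_right hr, hpb]
  have hqI : ∀ r ∈ Set.Icc a b, q r = p r / ρ r := by
    intro r hr
    have : 1 ≤ 2 * r / a - 1 := by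
      rw [le_sub_iff_add_le, le_div_iff₀ ha]
      linarith [hr.1]
    simp [hq, min_eq_left hr.2, min_eq_left this]
  refine ⟨fun r => 1 - ∫ s in r..b, q s, q, hqc, fun r => ?_, fun r hr => ?_, hqb, hqI,
    fun r hr => ?_, fun r hr => ?_⟩
  · exact ((hasDerivAt_integral_lower hqc b r).const_sub 1).congr_deriv (neg_neg _)
  · have : 2 * r / a - 1 ≤ 0 := by
      rw [sub_nonpos, div_le_one ha]
      linarith
    simp [hq, max_eq_left ((min_le_right _ _).trans this)]
  · have e := h.sub_eq_integral hρ hpos r b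
    rw [h.v_right] at e
    have : ∫ s in r..b, q s = ∫ s in r..b, p s / ρ s := by
      refine intervalIntegral.integral_congr fun s hs => ?_
      rw [Set.uIcc_of_le hr.2] at hs
      exact hqI s ⟨hr.1.trans hs.1, hs.2⟩
    simp only [this, ← e]
    ring
  · have : ∫ s in r..b, q s = 0 := by
      rw [intervalIntegral.integral_zero_ae (.of_forall fun s hs => ?_)]
      rw [Set.uIoc_of_ge hr] at hs
      exact hqb s hs.1.le
    simp [this]

section Euclidean

variable {N : ℕ}

theorem contDiff_radial {ψ q : ℝ → ℝ} {ε : ℝ} (hε : 0 < ε) (hq : Continuous q)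
    (hψ : ∀ r, HasDerivAt ψ (q r) r) (hq0 : ∀ r ≤ ε, q r = 0) :
    ContDiff ℝ 1 fun x : EuclideanSpace ℝ (Fin N) => ψ ‖x‖ := by
  have hψ1 : ContDiff ℝ 1 ψ := by
    rw [contDiff_one_iff_deriv]
    exact ⟨fun r => (hψ r).differentiableAt, by rwa [funext fun r => (hψ r).deriv]⟩
  refine contDiff_iff_contDiffAt.2 fun x => ?_
  rcases eq_or_ne x 0 with rfl | hx
  · refine (contDiffAt_const (c := ψ 0)).congr_of_eventuallyEq ?_
    filter_upwards [ball_mem_nhds (0 : EuclideanSpace ℝ (Fin N)) hε] with x hx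
    rw [mem_ball_zero_iff] at hx
    have e := intervalIntegral.integral_eq_sub_of_hasDerivAt (a := 0) (b := ‖x‖)
      (fun r _ => hψ r) (hq.intervalIntegrable _ _)
    rw [intervalIntegral.integral_zero_ae (.of_forall fun s hs => ?_)] at e
    · linarith
    · rw [Set.uIoc_of_le (norm_nonneg x)] at hs
      exact hq0 s (hs.2.trans hx.le)
  · exact hψ1.contDiffAt.comp x (contDiffAt_norm ℝ hx)

theorem norm_gradient_radial {ψ q : ℝ → ℝ} (hψ : ∀ r, HasDerivAt ψ (q r) r)
    {x : EuclideanSpace ℝ (Fin N)} (hx : x ≠ 0) :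
    ‖gradient (fun x : EuclideanSpace ℝ (Fin N) => ψ ‖x‖) x‖ = |q ‖x‖| := by
  have hd : DifferentiableAt ℝ (fun x : EuclideanSpace ℝ (Fin N) => ‖x‖) x :=
    (contDiffAt_norm ℝ hx (n := 1)).differentiableAt one_ne_zero
  have h := (hψ ‖x‖).comp_hasFDerivAt x hd.hasFDerivAt
  have : Nontrivial (EuclideanSpace ℝ (Fin N)) := ⟨⟨x, 0, hx⟩⟩
  rw [gradient, LinearIsometryEquiv.norm_map]
  have e : fderiv ℝ (fun x : EuclideanSpace ℝ (Fin N) => ψ ‖x‖) x = _ := h.fderiv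
  rw [e, norm_smul, norm_fderiv_norm hd, mul_one, Real.norm_eq_abs]

theorem memH1_of_contDiff {w : EuclideanSpace ℝ (Fin N) → ℝ} (hw : ContDiff ℝ 1 w)
    {Ω : Set (EuclideanSpace ℝ (Fin N))} (hΩ : Bornology.IsBounded Ω) :
    MemH1 Ω w (gradient w) := by
  have hgc := continuous_gradient_of_contDiff hw
  refine ⟨hw.continuous.memLp_restrict_of_isBounded hΩ, hgc.memLp_restrict_of_isBounded hΩ,
    fun φ hφ hφc hφΩ v => ?_⟩
  have hφd : Continuous fun x => fderiv ℝ φ x v :=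
    (hφ.continuous_fderiv (by simp)).clm_apply continuous_const
  have hwd : Continuous fun x => fderiv ℝ w x v :=
    (hw.continuous_fderiv one_ne_zero).clm_apply continuous_const
  have hφdc : HasCompactSupport fun x => fderiv ℝ φ x v := hφc.fderiv_apply ℝ v
  have hout : ∀ x, x ∉ Ω → φ x = 0 := fun x hx => image_eq_zero_of_notMem_tsupport (hx <| hφΩ ·)
  have hout' : ∀ x, x ∉ Ω → fderiv ℝ φ x v = 0 := fun x hx => by
    rw [fderiv_of_notMem_tsupport ℝ (hx <| hφΩ ·)]
    rfl
  rw [setIntegral_eq_integral_of_forall_compl_eq_zero fun x hx => by rw [hout' x hx, mul_zero],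
    setIntegral_eq_integral_of_forall_compl_eq_zero fun x hx => by rw [hout x hx, mul_zero]]
  have := integral_mul_fderiv_eq_neg_fderiv_mul_of_integrable (μ := volume) (f := w) (g := φ)
    (v := v) ((hwd.mul hφ.continuous).integrable_of_hasCompactSupport hφc.mul_left)
    ((hw.continuous.mul hφd).integrable_of_hasCompactSupport hφdc.mul_left)
    ((hw.continuous.mul hφ.continuous).integrable_of_hasCompactSupport hφc.mul_left)
    (fun x _ => hw.differentiable one_ne_zero x)
    (fun x _ => hφ.differentiable (by simp) x)
  rw [this]
  simp [gradient]

theorem isTraceOnSphere_of_contDiff {w : EuclideanSpace ℝ (Fin N) → ℝ} (hw : ContDiff ℝ 1 w)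
    (Ω : Set (EuclideanSpace ℝ (Fin N))) (α : ℝ) :
    IsTraceOnSphere Ω α w (gradient w) w :=
  ⟨memLp_sphereSurface hw.continuous, fun _ => w, fun _ => hw, by simp, by simp, by simp⟩

theorem ae_norm_eq_sphereSurface {α : ℝ} (hα : 0 ≤ α) : ∀ᵐ x ∂sphereSurface N α, ‖x‖ = α := by
  refine Measure.ae_smul_measure ?_ _
  rw [ae_map_iff (by fun_prop) (measurableSet_eq_fun measurable_norm measurable_const)]
  refine .of_forall fun ξ => ?_
  rw [norm_smul, show ‖ξ.1‖ = 1 by simp, mul_one, Real.norm_of_nonneg hα]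

theorem setIntegral_sq_pos {Ω : Set (EuclideanSpace ℝ (Fin N))}
    {u : EuclideanSpace ℝ (Fin N) → ℝ} (hu : MemLp u 2 (volume.restrict Ω))
    (hu0 : ¬ u =ᵐ[volume.restrict Ω] 0) : 0 < ∫ x in Ω, u x ^ 2 := by
  refine lt_of_le_of_ne (integral_nonneg fun x => sq_nonneg _) fun h => hu0 ?_
  have := (integral_eq_zero_iff_of_nonneg (fun x => sq_nonneg (u x)) hu.integrable_sq).1 h.symm
  filter_upwards [this] with x hx
  exact pow_eq_zero_iff two_ne_zero |>.1 hx

/-- A set avoiding the ball of radius `a`, of the same volume as the annulus, has a Rayleigh value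
below the first eigenvalue of the annulus, strictly so if it misses part of the annulus. -/
theorem IsRobinGroundState.exists_rayleighValue (hN : 2 ≤ N) {a b τ : ℝ} {h : WithTop ℝ}
    {v p : ℝ → ℝ} (ha : 0 < a) (hab : a < b)
    (hs : IsRobinGroundState (fun r => max r a ^ (N - 1)) a b h τ v p)
    {Ω : Set (EuclideanSpace ℝ (Fin N))} (hΩo : IsOpen Ω) (hΩne : Ω.Nonempty)
    (hΩb : Bornology.IsBounded Ω) (hΩa : ∀ x ∈ Ω, a < ‖x‖)
    (hvol : volume (ball (0 : EuclideanSpace ℝ (Fin N)) b \ closedBall 0 a) = volume Ω) :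
    ∃ μ ∈ rayleighValues h a Ω, μ ≤ τ ∧
      (volume ((ball (0 : EuclideanSpace ℝ (Fin N)) b \ closedBall 0 a) \ Ω) ≠ 0 → μ < τ) := by
  have hρ : Continuous fun r : ℝ => max r a ^ (N - 1) := by fun_prop
  have hpos : ∀ r : ℝ, 0 < max r a ^ (N - 1) := fun r => pow_pos (lt_max_of_lt_right ha) _
  obtain ⟨ψ, q, hqc, hψ, hq0, hqb, hqI, hψI, hψb⟩ :=
    hs.toIsNeumannSolution.exists_extension hρ hpos ha hab.le
  set A := ball (0 : EuclideanSpace ℝ (Fin N)) b \ closedBall 0 a with hA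
  have hAm : MeasurableSet A := measurableSet_annulus a b
  have hAb : Bornology.IsBounded A := isBounded_ball.subset Set.sdiff_subset
  have hΩm := hΩo.measurableSet
  set w : EuclideanSpace ℝ (Fin N) → ℝ := fun x => ψ ‖x‖ with hw
  have hwC : ContDiff ℝ 1 w := contDiff_radial (half_pos ha) hqc hψ hq0
  have hψc : Continuous ψ := continuous_iff_continuousAt.2 fun r => (hψ r).continuousAt
  have hψpos : ∀ r, a < r → 0 < ψ r := by
    intro r hr
    rcases le_or_gt b r with hbr | hrb
    · rw [hψb r hbr]
      exact one_pos
    · rw [hψI r ⟨hr.le, hrb.le⟩]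
      exact hs.pos r ⟨hr, hrb.le⟩
  have hne : ¬ w =ᵐ[volume.restrict Ω] 0 := by
    intro h0
    have : ∀ᵐ _ ∂volume.restrict Ω, False := by
      filter_upwards [h0, ae_restrict_mem hΩm] with x hx hxΩ
      exact (hψpos ‖x‖ (hΩa x hxΩ)).ne' hx
    rw [eventually_false_iff_eq_bot, ae_eq_bot, Measure.restrict_eq_zero] at this
    exact hΩo.measure_ne_zero volume hΩne this
  have hH1 := memH1_of_contDiff hwC hΩb
  have hD := setIntegral_sq_pos hH1.memLp hne
  refine ⟨_, ⟨w, gradient w, w, hH1, isTraceOnSphere_of_contDiff hwC Ω a, fun hh => ?_, hne, rfl⟩,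
    ?_⟩
  · filter_upwards [ae_norm_eq_sphereSurface (N := N) ha.le] with x hx
    simp [hw, hx, hψI a ⟨le_rfl, hab.le⟩, hs.dirichlet hh]
  set f : EuclideanSpace ℝ (Fin N) → ℝ := fun x => q ‖x‖ ^ 2 - τ * ψ ‖x‖ ^ 2 with hf
  have hfc : Continuous f := by fun_prop
  have hfi : ∀ s : Set (EuclideanSpace ℝ (Fin N)), Bornology.IsBounded s → IntegrableOn f s :=
    fun s hs => hfc.integrableOn_of_isBounded hs
  have hqi : IntegrableOn (fun x : EuclideanSpace ℝ (Fin N) => q ‖x‖ ^ 2) Ω :=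
    (by fun_prop : Continuous fun x : EuclideanSpace ℝ (Fin N) =>
      q ‖x‖ ^ 2).integrableOn_of_isBounded hΩb
  have hψi : IntegrableOn (fun x : EuclideanSpace ℝ (Fin N) => ψ ‖x‖ ^ 2) Ω :=
    (by fun_prop : Continuous fun x : EuclideanSpace ℝ (Fin N) =>
      ψ ‖x‖ ^ 2).integrableOn_of_isBounded hΩb
  have hgrad : ∫ x in Ω, ‖gradient w x‖ ^ 2 = ∫ x in Ω, q ‖x‖ ^ 2 := by
    refine setIntegral_congr_fun hΩm fun x hx => ?_
    have hx0 : x ≠ 0 := norm_pos_iff.1 (ha.trans (hΩa x hx))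
    simp only [hw]
    rw [norm_gradient_radial hψ hx0, sq_abs]
  have hfΩ : ∫ x in Ω, f x = (∫ x in Ω, ‖gradient w x‖ ^ 2) - τ * ∫ x in Ω, w x ^ 2 := by
    rw [hgrad, ← integral_const_mul]
    exact integral_sub hqi (hψi.const_mul τ)
  -- On each ray the energy identity leaves `-p a * v a`, which the Robin condition evaluates; for
  -- `h = ⊤` both sides are 0.
  have hfA : ∫ x in A, f x = -(h.untopD 0 * ∫ x, w x ^ 2 ∂sphereSurface N a) := by
    have hwc2 : Continuous fun x => w x ^ 2 := hwC.continuous.pow 2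
    rw [hA, setIntegral_annulus_eq hN hfc ha hab.le, integral_sphereSurface ha.le hwc2]
    have hξ : ∀ ξ : sphere (0 : EuclideanSpace ℝ (Fin N)) 1, ∀ r : ℝ, 0 ≤ r → ‖r • ξ.1‖ = r :=
      fun ξ r hr => by rw [norm_smul, show ‖ξ.1‖ = 1 by simp, mul_one, Real.norm_of_nonneg hr]
    have hin : ∀ ξ : sphere (0 : EuclideanSpace ℝ (Fin N)) 1,
        ∫ r in a..b, r ^ (N - 1) * f (r • ξ.1) = -(h.untopD 0 * a ^ (N - 1) * v a ^ 2) := by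
      intro ξ
      have e := hs.integral_energy hρ hpos hab.le
      have hr := hs.robin
      simp only [max_self] at hr
      have hvc := hs.continuous_v
      have hpc := hs.continuous_p
      have i1 : IntervalIntegrable (fun r => max r a ^ (N - 1) * v r ^ 2) volume a b :=
        (by fun_prop : Continuous fun r => max r a ^ (N - 1) * v r ^ 2).intervalIntegrable _ _
      have i2 : IntervalIntegrable (fun r => max r a ^ (N - 1) * (p r / max r a ^ (N - 1)) ^ 2)
          volume a b :=
        (hρ.mul ((hpc.div hρ fun r => (hpos r).ne').pow 2)).intervalIntegrable _ _
      have : ∫ r in a..b, r ^ (N - 1) * f (r • ξ.1) =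
          ∫ r in a..b, (max r a ^ (N - 1) * (p r / max r a ^ (N - 1)) ^ 2 -
            τ * (max r a ^ (N - 1) * v r ^ 2)) := by
        refine intervalIntegral.integral_congr fun r hr => ?_
        rw [Set.uIcc_of_le hab.le] at hr
        simp only [hf, hξ ξ r (ha.le.trans hr.1), hqI r hr, hψI r hr, max_eq_left hr.1]
        ring
      rw [this, intervalIntegral.integral_sub i2 (i1.const_mul τ),
        intervalIntegral.integral_const_mul, ← e, hr]
      ring
    simp only [hin, hw, hξ _ a ha.le, hψI a ⟨le_rfl, hab.le⟩, integral_const, smul_eq_mul]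
    ring
  have hAΩ : volume (Ω \ A) = volume (A \ Ω) :=
    
    measure_sdiff_symm hΩm.nullMeasurableSet hAm.nullMeasurableSet hvol.symm
      (hAb.subset Set.inter_subset_right).measure_lt_top.ne
  have hdiff : ∫ x in Ω \ A, f x = ∫ _ in A \ Ω, -τ := by
    rw [setIntegral_congr_fun (hΩm.diff hAm) (g := fun _ => -τ) fun x hx => ?_]
    · simp [measureReal_def, hAΩ]
    · have hbx : b ≤ ‖x‖ := by
        by_contra! hlt
        exact hx.2 (mem_annulus_iff.2 ⟨hΩa x hx.1, hlt⟩)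
      simp [hf, hqb _ hbx, hψb _ hbx]
  have hsplit : ∫ x in Ω, f x = (∫ x in A, f x) - ∫ x in A \ Ω, (f x + τ) := by
    have hfin : volume (A \ Ω) ≠ ⊤ := (hAb.subset Set.sdiff_subset).measure_lt_top.ne
    rw [← integral_inter_add_sdiff hAm (hfi Ω hΩb), ← integral_inter_add_sdiff hΩm (hfi A hAb),
      integral_add (hfi _ (hAb.subset Set.sdiff_subset)) (integrableOn_const hfin), hdiff,
      Set.inter_comm, integral_neg]
    ring
  -- Here `f + τ = (p / ρ)² + (τ - τ v)(1 + v)`, and `τ v < τ v(b) = τ` inside the annulus.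
  have hfpos : ∀ x ∈ A, 0 < f x + τ := by
    intro x hx
    obtain ⟨hx1, hx2⟩ := mem_annulus_iff.1 hx
    have hxI : ‖x‖ ∈ Set.Icc a b := ⟨hx1.le, hx2.le⟩
    have hv0 : ∀ r ∈ Set.Icc a b, 0 ≤ v r := fun r hr => by
      rcases hr.1.eq_or_lt with rfl | h'
      · exact hs.nonneg_left
      · exact (hs.pos r ⟨h', hr.2⟩).le
    have h1 := hs.mul_lt_mul hρ hpos hs.ne_zero hv0 hx1.le hx2 le_rfl
    rw [hs.v_right, mul_one] at h1
    have h2 := hv0 _ hxI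
    simp only [hf, hqI _ hxI, hψI _ hxI]
    have : 0 < (τ - τ * v ‖x‖) * (1 + v ‖x‖) := mul_pos (by linarith) (by linarith)
    nlinarith [sq_nonneg (p ‖x‖ / max ‖x‖ a ^ (N - 1))]
  have hnn : 0 ≤ ∫ x in A \ Ω, (f x + τ) :=
    setIntegral_nonneg (hAm.diff hΩm) fun x hx => (hfpos x hx.1).le
  refine ⟨?_, fun hAΩ0 => ?_⟩
  · rw [div_le_iff₀ hD]
    linarith
  · have hi : IntegrableOn (fun x => f x + τ) (A \ Ω) :=
      (hfc.add continuous_const).integrableOn_of_isBounded (hAb.subset Set.sdiff_subset)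
    have hsupp : A \ Ω ⊆ Function.support fun x => f x + τ := fun x hx => (hfpos x hx.1).ne'
    have : 0 < ∫ x in A \ Ω, (f x + τ) := by
      rw [setIntegral_pos_iff_support_of_nonneg_ae
        (ae_restrict_of_forall_mem (hAm.diff hΩm) fun x hx => (hfpos x hx.1).le) hi,
        Set.inter_eq_right.2 hsupp]
      exact pos_iff_ne_zero.2 hAΩ0
    rw [div_lt_iff₀ hD]
    linarith

end Euclidean

/-! ### Rigidity and boundedness from below -/

section Euclidean

variable {N : ℕ}

/-- A Lipschitz set which fills an open set up to a null set contains it. -/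
theorem HasLipschitzBoundary.subset_of_measure_sdiff_eq_zero {Ω A : Set (EuclideanSpace ℝ (Fin N))}
    (hΩ : HasLipschitzBoundary Ω) (hA : IsOpen A) (hnull : volume (A \ Ω) = 0) : A ⊆ Ω := by
  intro x hx
  by_contra hxΩ
  have hnot : ∀ V : Set (EuclideanSpace ℝ (Fin N)), IsOpen V → V ⊆ A \ Ω → V = ∅ := fun V hV hVA =>
    hV.measure_eq_zero_iff volume |>.1 (measure_mono_null hVA hnull)
  have hcl : x ∈ closure Ω := by
    by_contra hcl
    have := hnot (A \ closure Ω) (hA.sdiff isClosed_closure)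
      (Set.sdiff_subset_sdiff_right subset_closure)
    exact (this ▸ (⟨hx, hcl⟩ : x ∈ A \ closure Ω) : x ∈ (∅ : Set _))
  obtain ⟨e, K, γ, U, he, hγ, hU, hxU, hgraph⟩ := hΩ x ⟨hcl, fun h => hxΩ (interior_subset h)⟩
  have hcγ : Continuous fun y : EuclideanSpace ℝ (Fin N) => γ (y - inner ℝ e y • e) :=
    hγ.continuous.comp (by fun_prop)
  have hci : Continuous fun y : EuclideanSpace ℝ (Fin N) => inner ℝ e y := by fun_prop
  -- The strict subgraph near `x` is an open part of A \ Ω, hence empty; yet moving `x` slightly in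
  -- the direction `-e` lands in it.
  have hempty := hnot ((A ∩ U) ∩ {y | inner ℝ e y < γ (y - inner ℝ e y • e)})
    ((hA.inter hU).inter (isOpen_lt hci hcγ))
    fun y hy => ⟨hy.1.1, fun hyΩ => lt_asymm ((hgraph y hy.1.2).1 hyΩ) hy.2⟩
  have hlim : Tendsto (fun t : ℝ => x - t • e) (𝓝[>] 0) (𝓝 x) := by
    have : Continuous fun t : ℝ => x - t • e := by fun_prop
    simpa using (this.tendsto 0).mono_left nhdsWithin_le_nhds
  obtain ⟨t, ht, htpos⟩ := ((hlim.eventually ((hA.inter hU).mem_nhds ⟨hx, hxU⟩)).and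
    (eventually_mem_nhdsWithin (a := (0 : ℝ)) (s := Set.Ioi 0))).exists
  have hinner : inner ℝ e (x - t • e) = inner ℝ e x - t := by
    rw [inner_sub_right, real_inner_smul_right, real_inner_self_eq_norm_sq, he]
    ring
  have hle : inner ℝ e x ≤ γ (x - inner ℝ e x • e) := not_lt.1 fun h => hxΩ ((hgraph x hxU).2 h)
  have hmem : x - t • e ∈ (A ∩ U) ∩ {y | inner ℝ e y < γ (y - inner ℝ e y • e)} := by
    refine ⟨ht, ?_⟩
    have : x - t • e - (inner ℝ e x - t) • e = x - inner ℝ e x • e := by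
      rw [sub_smul]
      abel
    simp only [Set.mem_ofPred_eq, hinner, this]
    linarith [Set.mem_Ioi.1 htpos]
  rw [hempty] at hmem
  exact hmem

/-- An open set outside the ball of radius `a` that is contained in the annulus up to a null set is
contained in it. -/
theorem subset_annulus_of_measure_sdiff_eq_zero {a b : ℝ} (hb : b ≠ 0)
    {Ω : Set (EuclideanSpace ℝ (Fin N))} (hΩ : IsOpen Ω) (hΩa : ∀ x ∈ Ω, a < ‖x‖)
    (hnull : volume (Ω \ (ball (0 : EuclideanSpace ℝ (Fin N)) b \ closedBall 0 a)) = 0) :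
    Ω ⊆ ball (0 : EuclideanSpace ℝ (Fin N)) b \ closedBall 0 a := by
  have h1 : Ω \ closedBall 0 b = ∅ := by
    refine ((hΩ.sdiff isClosed_closedBall).measure_eq_zero_iff volume).1
      (measure_mono_null (Set.sdiff_subset_sdiff_right ?_) hnull)
    exact Set.sdiff_subset.trans ball_subset_closedBall
  have h2 : Ω ⊆ closedBall 0 b := Set.sdiff_eq_empty.1 h1
  have h3 : Ω ⊆ ball 0 b := by
    rw [← interior_closedBall _ hb]
    exact interior_maximal h2 hΩ
  exact fun x hx => mem_annulus_iff.2 ⟨hΩa x hx, mem_ball_zero_iff.1 (h3 hx)⟩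

theorem MemH1.le_div_of_mul_le {Ω : Set (EuclideanSpace ℝ (Fin N))}
    {u : EuclideanSpace ℝ (Fin N) → ℝ}
    {g : EuclideanSpace ℝ (Fin N) → EuclideanSpace ℝ (Fin N)} (hu : MemH1 Ω u g)
    (hu0 : ¬ u =ᵐ[volume.restrict Ω] 0) {τ E : ℝ} (h : τ * ∫ x in Ω, u x ^ 2 ≤ E) :
    τ ≤ E / ∫ x in Ω, u x ^ 2 :=
  (le_div_iff₀ (setIntegral_sq_pos hu.memLp hu0)).2 h

/-- For `h ≥ 0` the quotients are nonnegative. For `h < 0` the ground state of any annulus inside Ω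
that touches the sphere already controls the boundary term; its eigenvalue is negative, so enlarging
the annulus to Ω preserves the bound. -/
theorem bddBelow_rayleighValues (hN : 2 ≤ N) {h : WithTop ℝ} {a b : ℝ} (ha : 0 < a)
    (hab : a < b) {Ω : Set (EuclideanSpace ℝ (Fin N))}
    (hΩ : ball (0 : EuclideanSpace ℝ (Fin N)) b \ closedBall 0 a ⊆ Ω) :
    BddBelow (rayleighValues h a Ω) := by
  rcases lt_or_ge h 0 with hh | hh
  · obtain ⟨τ, v, p, hs⟩ := exists_robinGroundState (ρ := fun r => max r a ^ (N - 1)) (by fun_prop)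
      (fun r => pow_pos (lt_max_of_lt_right ha) _) hab hh.ne
    refine ⟨τ, ?_⟩
    rintro _ ⟨u, g, T, hu, hT, hT0, hu0, rfl⟩
    refine hu.le_div_of_mul_le hu0 ?_
    have h1 := hs.mul_setIntegral_sq_le hN ha hab.le hΩ hu hT hT0
    have h2 : ∫ x in ball (0 : EuclideanSpace ℝ (Fin N)) b \ closedBall 0 a, u x ^ 2 ≤
        ∫ x in Ω, u x ^ 2 :=
      setIntegral_mono_set hu.memLp.integrable_sq (.of_forall fun x => sq_nonneg _)
        hΩ.eventuallyLE
    have h3 : ∫ x in ball (0 : EuclideanSpace ℝ (Fin N)) b \ closedBall 0 a, ‖g x‖ ^ 2 ≤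
        ∫ x in Ω, ‖g x‖ ^ 2 :=
      setIntegral_mono_set hu.memLp_grad.norm.integrable_sq (.of_forall fun x => sq_nonneg _)
        hΩ.eventuallyLE
    nlinarith [mul_le_mul_of_nonpos_left h2 (hs.neg_of_neg hh).le]
  · refine ⟨0, ?_⟩
    rintro _ ⟨u, g, T, -, -, -, -, rfl⟩
    have h0 : 0 ≤ h.untopD 0 := by
      cases h with
      | top => simp
      | coe h => simpa using hh
    have h1 : 0 ≤ ∫ x, T x ^ 2 ∂sphereSurface N a := integral_nonneg fun x => sq_nonneg _
    have h2 : 0 ≤ ∫ x in Ω, ‖g x‖ ^ 2 := integral_nonneg fun x => sq_nonneg _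
    have h3 : 0 ≤ ∫ x in Ω, u x ^ 2 := integral_nonneg fun x => sq_nonneg _
    positivity

theorem exists_annulus_subset {Ωout : Set (EuclideanSpace ℝ (Fin N))} (hΩ : IsOpen Ωout) {a : ℝ}
    (ha : 0 < a) (hsub : closedBall 0 a ⊆ Ωout) :
    ∃ b, a < b ∧ ball (0 : EuclideanSpace ℝ (Fin N)) b \ closedBall 0 a ⊆
      Ωout \ closedBall 0 a := by
  obtain ⟨δ, hδ, h⟩ := (isCompact_closedBall (0 : EuclideanSpace ℝ (Fin N))
    a).exists_thickening_subset_open hΩ hsub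
  rw [thickening_closedBall hδ ha.le] at h
  exact ⟨δ + a, by linarith, Set.sdiff_subset_sdiff_left h⟩

end Euclidean

/-! ### Comparison and the equality case -/

theorem theorem1p1 (N : ℕ) (hN : 2 ≤ N) (h : WithTop ℝ) (hh : h ≠ 0) (α β : ℝ)
    (Ωout : Set (EuclideanSpace ℝ (Fin N))) (hA : AssumptionA Ωout α) (hαβ : α < β)
    (hvol : volume (ball (0 : EuclideanSpace ℝ (Fin N)) β \ closedBall 0 α) =
      volume (Ωout \ closedBall 0 α)) :
    IsGLB (rayleighValues h α (Ωout \ closedBall 0 α))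
        (firstEigenvalue h α (Ωout \ closedBall 0 α)) ∧
      IsGLB (rayleighValues h α (ball (0 : EuclideanSpace ℝ (Fin N)) β \ closedBall 0 α))
        (firstEigenvalue h α (ball (0 : EuclideanSpace ℝ (Fin N)) β \ closedBall 0 α)) ∧
      firstEigenvalue h α (Ωout \ closedBall 0 α) ≤
        firstEigenvalue h α (ball (0 : EuclideanSpace ℝ (Fin N)) β \ closedBall 0 α) ∧
      (firstEigenvalue h α (Ωout \ closedBall 0 α) =
          firstEigenvalue h α (ball (0 : EuclideanSpace ℝ (Fin N)) β \ closedBall 0 α) ↔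
        Ωout \ closedBall 0 α = ball (0 : EuclideanSpace ℝ (Fin N)) β \ closedBall 0 α) := by
  have hα := hA.pos
  obtain ⟨b, hab, hb⟩ := exists_annulus_subset hA.isOpen_out hα hA.compactly_contained
  have hdom := hA.domain
  have hΩa : ∀ x ∈ Ωout \ closedBall 0 α, α < ‖x‖ := fun x hx => by simpa using hx.2
  set Ω := Ωout \ closedBall (0 : EuclideanSpace ℝ (Fin N)) α
  set A := ball (0 : EuclideanSpace ℝ (Fin N)) β \ closedBall 0 α with hAdef
  have hAo : IsOpen A := isOpen_ball.sdiff isClosed_closedBall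
  have hAb : Bornology.IsBounded A := isBounded_ball.subset Set.sdiff_subset
  have hAne : A.Nonempty := by
    rw [Set.nonempty_iff_ne_empty]
    intro h0
    rw [h0, measure_empty] at hvol
    exact hdom.isOpen.measure_ne_zero volume hdom.isConnected.nonempty hvol.symm
  obtain ⟨τ, v, p, hs⟩ := exists_robinGroundState (ρ := fun r => max r α ^ (N - 1)) (by fun_prop)
    (fun r => pow_pos (lt_max_of_lt_right hα) _) hαβ hh
  obtain ⟨μ, hμ, hμτ, hμlt⟩ := hs.exists_rayleighValue hN hα hαβ hdom.isOpen
    hdom.isConnected.nonempty hdom.isBounded hΩa hvol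
  obtain ⟨ν, hν, -⟩ := hs.exists_rayleighValue hN hα hαβ hAo hAne hAb
    (fun x hx => (mem_annulus_iff.1 hx).1) rfl
  -- The thin annulus up to `b` is needed here, since A itself need not lie in Ω.
  have hbddΩ : BddBelow (rayleighValues h α Ω) := bddBelow_rayleighValues hN hα hab hb
  have hbddA : BddBelow (rayleighValues h α A) := bddBelow_rayleighValues hN hα hαβ subset_rfl
  have hτA : τ ≤ firstEigenvalue h α A := by
    refine le_csInf ⟨ν, hν⟩ ?_
    rintro _ ⟨u, g, T, hu, hT, hT0, hu0, rfl⟩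
    exact hu.le_div_of_mul_le hu0 (hs.mul_setIntegral_sq_le hN hα hαβ.le subset_rfl hu hT hT0)
  have hΩμ : firstEigenvalue h α Ω ≤ μ := csInf_le hbddΩ hμ
  refine ⟨isGLB_csInf ⟨μ, hμ⟩ hbddΩ, isGLB_csInf ⟨ν, hν⟩ hbddA, (hΩμ.trans hμτ).trans hτA,
    fun heq => ?_, fun heq => by rw [heq]⟩
  have hnull : volume (A \ Ω) = 0 := by
    by_contra h0
    exact absurd heq ((hΩμ.trans_lt (hμlt h0)).trans_le hτA).ne
  have hnull' : volume (Ω \ A) = 0 := by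
    rw [measure_sdiff_symm hdom.isOpen.measurableSet.nullMeasurableSet
      hAo.measurableSet.nullMeasurableSet hvol.symm
      (hAb.subset Set.inter_subset_right).measure_lt_top.ne, hnull]
  exact Set.Subset.antisymm
    (subset_annulus_of_measure_sdiff_eq_zero (hα.trans hαβ).ne' hdom.isOpen hΩa hnull')
    (hdom.lipschitz.subset_of_measure_sdiff_eq_zero hAo hnull)
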